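/- **Conventions.** Let $F_n$ be the free group on $x_1,\dots,x_n$; for $n=2$ write $F_2=F(a,b)$. An element of $F_n$ is *primitive* if it belongs to a free basis of $F_n$. Let $X$ be a wedge of $n$ circles, $\pi_1(X)=F_n$, let $\phi\colon F_n\to G$ be a surjection onto a finite group, and let $Y\to X$ be the corresponding regular cover with deck group $G$: it is the graph with vertex set $G$ and with an edge from $g$ to $g\,\phi(x_i)$ for all $g\in G$, $1\le i\le n$, on which $G$ acts by left multiplication. An *elevation* of $\gamma\in F_n$ is a closed path in $Y$ that is a lift of $\gamma^k$, starting at any vertex, where $k\ge 1$ is smallest with $\phi(\gamma)^k=1$. The *primitive homology* $H_1^{\mathrm{prim}}(Y;\mathbb C)\subseteq H_1(Y;\mathbb C)$ is the $\mathbb C$-span of the classes of all elevations of all primitive elements of $F_n$. Let $\mathrm{Irr}(G)$ be the set of isomorphism classes of complex irreducible representations of $G$, and let $\mathrm{Irr}^{\mathrm{pr}}(\phi,G)\subseteq \mathrm{Irr}(G)$ be the set of classes of those $V$ for which $\phi(\gamma)v=v$ for some primitive $\gamma\in F_n$ and some nonzero $v\in V$. Write $[a,b]=aba^{-1}b^{-1}$.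 **Theorem (rank two counterexamples).** There exist a finite group $G$ of nilpotency class exactly $2$ and a surjection $\phi\colon F_2\to G$ such that, for the associated cover $Y$ of the wedge of two circles, $$\mathrm{Irr}^{\mathrm{pr}}(\phi,G)\subsetneq \mathrm{Irr}(G)\qquad\text{and}\qquad H_1^{\mathrm{prim}}(Y;\mathbb C)\subsetneq H_1(Y;\mathbb C). \tag{$*$}$$ Moreover, $(*)$ holds in each of the following examples. 1. $G=\langle a,b\mid a^3=1,\ b^8=1,\ bab^{-1}=a^2\rangle$ with the quotient map $\phi\colon F(a,b)\to G$. This group has order $24$ and acts freely and linearly (by isometries) on some sphere $S^N$, and $\ker\phi$ contains no primitive element. 2. $\Gamma=\langle a,b\mid a^4=b^4=[a,b]^2=1,\ [a,b]\text{ central}\rangle$ with the quotient map $\phi\colon F(a,b)\to\Gamma$. This group has order $32$ and nilpotency class $2$; there is an exact sequence $1\to\mathbb Z/2\to\Gamma\to(\mathbb Z/4)^2\to1$ in which the composite $F_2\to\Gamma\to(\mathbb Z/4)^2$ is the mod-$4$ homology map; and $\ker\phi$ contains no primitive element. There is an irreducible representation $\rho\colon\Gamma\to GL_2(\mathbb C)$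 with $$\rho(\phi(a))=\begin{pmatrix} i&0\\0&-i\end{pmatrix},\qquad \rho(\phi(b))=\begin{pmatrix}0&1\\-1&0\end{pmatrix},$$ such that $\rho(\phi(x))$ does not have eigenvalue $1$ for any primitive $x\in F_2$, so that the class of $\rho$ is not in $\mathrm{Irr}^{\mathrm{pr}}(\phi,\Gamma)$. Moreover $\rho$ is not faithful: $\phi(a^2[a,b])\ne1$ while $\rho(\phi(a^2[a,b]))=1$. 3. For every prime $p$, the group $G=F_2/\bigl([K,K]K^p\bigr)$ with the quotient map $\phi$, where $K=[F_2,F_2]F_2^{\,2}$ is the kernel of the mod-$2$ homology map $F_2\to(\mathbb Z/2)^2$; here $H^m$ denotes the subgroup generated by the $m$-th powers of elements of $H$. This is the group of the mod-$p$ homology cover of the mod-$2$ homology cover of the torus with one boundary component. The group $G$ is finite and there is an exact sequence $1\to(\mathbb Z/p)^5\to G\to(\mathbb Z/2)^2\to1$ in which the composite $F_2\to G\to(\mathbb Z/2)^2$ is the mod-$2$ homology map. -/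

import Mathlib

namespace PrimitiveHomology

/-! ### Primitive elements and irreducible representations -/

/-- An element of a free group is primitive if it belongs to some free basis of the group. -/
def IsPrimitive {n : ℕ} (x : FreeGroup (Fin n)) : Prop :=
  ∃ (b : FreeGroupBasis (Fin n) (FreeGroup (Fin n))) (i : Fin n), b i = x

/-- A (finite-dimensional) complex irreducible representation of `G`, on a space `ℂ^dim`. -/
structure IrrRep (G : Type*) [Group G] where
  /-- the dimension -/
  dim : ℕ
  /-- the representation -/
  rep : Representation ℂ G (Fin dim → ℂ)
  /-- it is irreducible -/
  irreducible : rep.IsIrreducible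

/-- Isomorphism of irreducible representations. -/
instance irrSetoid (G : Type*) [Group G] : Setoid (IrrRep G) where
  r V W := Nonempty (V.rep.Equiv W.rep)
  iseqv :=
    { refl := fun V => ⟨Representation.Equiv.refl V.rep⟩
      symm := fun ⟨e⟩ => ⟨e.symm⟩
      trans := fun ⟨e⟩ ⟨f⟩ => ⟨e.trans f⟩ }

/-- The type of isomorphism classes of complex irreducible representations of the
finite group `G`. -/
def Irr (G : Type*) [Group G] : Type _ := Quotient (irrSetoid G)

/-- The isomorphism class of an irreducible representation. -/
def IrrRep.cls {G : Type*} [Group G] (V : IrrRep G) : Irr G := Quotient.mk (irrSetoid G) V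

/-- The set of classes of irreducible representations `V` of `G` in which the image under `φ` of
some primitive element of the free group fixes some nonzero vector. -/
def IrrPr {G : Type*} [Group G] {n : ℕ} (φ : FreeGroup (Fin n) →* G) : Set (Irr G) :=
  {c | ∃ V : IrrRep G, V.cls = c ∧
    ∃ γ : FreeGroup (Fin n), IsPrimitive γ ∧ ∃ v : Fin V.dim → ℂ, v ≠ 0 ∧ V.rep (φ γ) v = v}

/-! ### Graphs, their first homology, and the cover of a wedge of circles -/

/-- A graph with vertex set `V` and edge set `E`, each edge with an orientation (loops and multiple
edges allowed). -/
structure OrientedGraph (V E : Type*) where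
  /-- initial vertex of an edge -/
  src : E → V
  /-- terminal vertex of an edge -/
  tgt : E → V

/-- The cellular boundary map `C₁(Y;ℂ) → C₀(Y;ℂ)`. -/
noncomputable def OrientedGraph.boundary {V E : Type*} (Y : OrientedGraph V E) :
    (E →₀ ℂ) →ₗ[ℂ] (V →₀ ℂ) :=
  Finsupp.linearCombination ℂ
    (fun e => Finsupp.single (Y.tgt e) (1 : ℂ) - Finsupp.single (Y.src e) 1)

/-- `H₁(Y;ℂ)`. A graph has no 2-cells, so this is the space of 1-cycles. -/
noncomputable def OrientedGraph.H1 {V E : Type*} (Y : OrientedGraph V E) :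
    Submodule ℂ (E →₀ ℂ) :=
  LinearMap.ker Y.boundary

/-- The 1-chain of an edge path; `(e, true)` is the edge `e` traversed along its orientation,
`(e, false)` is `e` traversed backwards. -/
noncomputable def pathChain {E : Type*} (p : List (E × Bool)) : E →₀ ℂ :=
  (p.map fun d => if d.2 then Finsupp.single d.1 (1 : ℂ) else -Finsupp.single d.1 1).sum

section Cover

variable {G : Type*} [Group G] {n : ℕ} (φ : FreeGroup (Fin n) →* G)

/-- The covering graph `Y` of the wedge `X` of `n` circles determined by `φ : π₁(X) = F_n → G`.
Its vertices are the elements of `G`; over the `i`-th circle it has the edges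
`(g, i) : g ⟶ g * φ(xᵢ)`. The group `G` acts by deck transformations through left multiplication,
and the edge path which starts at the vertex `1` and spells a word `w` ends at `φ(w)`, so that it is
closed exactly when `w` is in the kernel of `φ`. -/
def coverGraph : OrientedGraph G (G × Fin n) where
  src e := e.1
  tgt e := e.1 * φ (FreeGroup.of e.2)

/-- The lift to `Y`, starting at the vertex `g`, of the edge path of `X` spelling a word; the letter
`(i, true)` stands for `xᵢ` and `(i, false)` for its inverse. -/
def liftPath : G → List (Fin n × Bool) → List ((G × Fin n) × Bool)
  | _, [] => []
  | g, (i, true) :: w => ((g, i), true) :: liftPath (g * φ (FreeGroup.of i)) w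
  | g, (i, false) :: w =>
      ((g * (φ (FreeGroup.of i))⁻¹, i), false) :: liftPath (g * (φ (FreeGroup.of i))⁻¹) w

/-- The homology class of the elevation of `γ` at the vertex `g`: the lift, starting at `g`, of the
smallest positive power `γ ^ k` whose lifts are closed, that is, with `φ(γ) ^ k = 1`. -/
noncomputable def elevation (g : G) (γ : FreeGroup (Fin n)) : (G × Fin n) →₀ ℂ :=
  pathChain (liftPath φ g (γ ^ orderOf (φ γ)).toWord)

/-- The primitive homology of `Y`: the span of the classes of all elevations of primitive elements
of `π₁(X)`. -/
noncomputable def H1prim : Submodule ℂ ((G × Fin n) →₀ ℂ) :=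
  Submodule.span ℂ {c | ∃ γ : FreeGroup (Fin n), IsPrimitive γ ∧ ∃ g : G, c = elevation φ g γ}

end Cover

/-! ### Groups in the examples -/

/-- `G` acts freely and linearly (by isometries) on some sphere `S^N`. -/
def ActsFreelyLinearlyOnSphere (G : Type*) [Group G] : Prop :=
  ∃ (N : ℕ) (ρ : G →* (EuclideanSpace ℝ (Fin (N + 1)) ≃ₗᵢ[ℝ] EuclideanSpace ℝ (Fin (N + 1)))),
    ∀ g : G, g ≠ 1 → ∀ v ∈ Metric.sphere (0 : EuclideanSpace ℝ (Fin (N + 1))) 1, ρ g v ≠ v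

/-- The generator `a` of the free group `F(a, b)`. -/
def genA : FreeGroup (Fin 2) := FreeGroup.of 0

/-- The generator `b` of the free group `F(a, b)`. -/
def genB : FreeGroup (Fin 2) := FreeGroup.of 1

/-- The commutator `[a, b]` in `F(a, b)`. -/
def genC : FreeGroup (Fin 2) := genA * genB * genA⁻¹ * genB⁻¹

/-- The relators of `⟨a, b | a³ = 1, b⁸ = 1, b a b⁻¹ = a²⟩`. -/
def sphereRels : Set (FreeGroup (Fin 2)) :=
  {genA ^ 3, genB ^ 8, genB * genA * genB⁻¹ * (genA ^ 2)⁻¹}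

/-- The relators of `⟨a, b | a⁴ = b⁴ = [a,b]² = 1, [a,b] central⟩`. -/
def nilRels : Set (FreeGroup (Fin 2)) :=
  {genA ^ 4, genB ^ 4, genC ^ 2, genC * genA * genC⁻¹ * genA⁻¹, genC * genB * genC⁻¹ * genB⁻¹}

/-- The mod-`m` homology map `F_n → H₁(F_n; ℤ/m) = (ℤ/m)^n`. -/
def modHomology (n m : ℕ) : FreeGroup (Fin n) →* Multiplicative (Fin n → ZMod m) :=
  FreeGroup.lift fun i => Multiplicative.ofAdd (Pi.single i 1)

/-- The subgroup `[H,H] H^m`, the kernel of `H → H₁(H; ℤ/m)`: if `H` is the fundamental group of a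
space, this subgroup corresponds to the mod-`m` homology cover of that space. -/
def modHomologyKernel {F : Type*} [Group F] (m : ℕ) (H : Subgroup F) : Subgroup F :=
  ⁅H, H⁆ ⊔ Subgroup.closure {x | ∃ h ∈ H, x = h ^ m}

instance modHomologyKernel_normal {F : Type*} [Group F] (m : ℕ) (H : Subgroup F) [hH : H.Normal] :
    (modHomologyKernel m H).Normal := by
  have h1 : (Subgroup.closure {x | ∃ h ∈ H, x = h ^ m}).Normal := by
    constructor
    intro x hx g
    have h2 : Subgroup.closure {x | ∃ h ∈ H, x = h ^ m} ≤
        (Subgroup.closure {x | ∃ h ∈ H, x = h ^ m}).comap (MulAut.conj g).toMonoidHom := by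
      rw [Subgroup.closure_le]
      rintro _ ⟨h, hh, rfl⟩
      refine Subgroup.subset_closure ⟨g * h * g⁻¹, hH.conj_mem h hh g, ?_⟩
      simp [conj_pow]
    exact h2 hx
  unfold modHomologyKernel
  infer_instance

/-- The subgroup of `F_2` of the iterated homology cover: the mod-`p` homology cover of the mod-`2`
homology cover of the torus with one boundary component. -/
def torusKernel (p : ℕ) : Subgroup (FreeGroup (Fin 2)) :=
  modHomologyKernel p (modHomologyKernel 2 ⊤)

instance torusKernel_normal (p : ℕ) : (torusKernel p).Normal := by
  unfold torusKernel
  infer_instance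

end PrimitiveHomology

open PrimitiveHomology

/-!
Let `ρ` be a nonzero representation of `G` in which no image `φ γ` of a primitive element `γ` fixes
a nonzero vector. An irreducible constituent of `ρ` has the same property, so it lies outside
`IrrPr φ`. The representation also shows that `H1prim φ` is too small. A `G`-equivariant functional
from the 1-chains of the cover to `ρ` sends an elevation of `γ` to a translate of a sum over the
powers of `φ γ`, hence of a vector fixed by `φ γ`; so it kills the primitive homology. If all these
functionals vanished on `H₁`, each would factor through the boundary map, and averaging over `G`
would give a vector which is fixed by the first generator but moved by the second
(`PrimitiveFixesNoVector.H1prim_lt_H1`, `PrimitiveFixesNoVector.IrrPr_ssubset_univ`).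

It remains to find such a representation in each example. The only property of a primitive element
that is needed is `IsPrimitive.exists_forall_mem_zpowers`: a quotient in which it dies is cyclic.

* The group of order 24 acts freely on the unit sphere of `ℂ² = ℝ⁴`, and it is not cyclic, so
  primitive elements survive in it and fix no nonzero vector.
* The group of order 32 and the group for `p = 2` map onto the quaternion group, which acts freely
  on `ℂ² \ {0}` and is not cyclic.
* For odd `p`, the group has three dihedral quotients of order `2 * p`, one for each epimorphism of
  the free group onto `ℤ/2`. A primitive element is a rotation in exactly one of them and a
  reflection in the other two. The rotation is nontrivial because the dihedral group is not cyclic.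
  In the tensor product of the three standard representations the square of the element is therefore
  a rotation without eigenvalue `1` in one factor and the identity in the others.

The orders of the two presented groups and the exact sequence for the one of order 32 come from
normal forms for their elements, distinguished by explicit quotients. For the iterated covers, the
kernel `K` of the mod-2 homology map is generated by five Schreier generators, and the passages of a
lifted path through the five edges outside a spanning tree of the four-sheeted cover show that these
generators stay independent modulo `p`.
-/

open scoped commutatorElement TensorProduct

namespace PrimitiveHomology

/-! ### Bases of the free group of rank two -/

/-- A homomorphism from the free group of rank two that kills a primitive element `x` has cyclic
image, generated by the image of the other member of a basis that contains `x`. -/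
theorem IsPrimitive.exists_forall_mem_zpowers {x : FreeGroup (Fin 2)} (hx : IsPrimitive x) :
    ∃ y : FreeGroup (Fin 2), ∀ {H : Type} [Group H] (f : FreeGroup (Fin 2) →* H), f x = 1 →
      ∀ u, f u ∈ Subgroup.zpowers (f y) := by
  obtain ⟨B, i, rfl⟩ := hx
  refine ⟨B (1 - i), fun {H} _ f hf u => ?_⟩
  have h : ∀ w : FreeGroup (Fin 2), f (B.repr.symm w) ∈ Subgroup.zpowers (f (B (1 - i))) := by
    intro w
    induction w using FreeGroup.induction_on with
    | C1 => simp
    | of j =>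
      change f (B j) ∈ _
      by_cases hj : j = i
      · rw [hj, hf]; exact one_mem _
      · have : j = 1 - i := by omega
        rw [this]; exact Subgroup.mem_zpowers _
    | inv_of j ih => rw [map_inv, map_inv]; exact inv_mem ih
    | mul a b ha hb => rw [map_mul, map_mul]; exact mul_mem ha hb
  simpa using h (B.repr u)

theorem IsPrimitive.commute {x : FreeGroup (Fin 2)} (hx : IsPrimitive x) {H : Type} [Group H]
    (f : FreeGroup (Fin 2) →* H) (hf : f x = 1) (u v : FreeGroup (Fin 2)) :
    Commute (f u) (f v) := by
  obtain ⟨y, hy⟩ := hx.exists_forall_mem_zpowers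
  obtain ⟨m, hm⟩ := Subgroup.mem_zpowers_iff.1 (hy f hf u)
  obtain ⟨n, hn⟩ := Subgroup.mem_zpowers_iff.1 (hy f hf v)
  rw [← hm, ← hn]
  exact (Commute.refl (f y)).zpow_zpow m n

/-! ### Chains of lifted paths -/

section Cover

variable {G : Type*} [Group G] {n : ℕ} (φ : FreeGroup (Fin n) →* G)

theorem pathChain_append {E : Type*} (p q : List (E × Bool)) :
    pathChain (p ++ q) = pathChain p + pathChain q := by
  simp [pathChain]

theorem liftPath_append (g : G) (v w : List (Fin n × Bool)) :
    liftPath φ g (v ++ w) = liftPath φ g v ++ liftPath φ (g * φ (FreeGroup.mk v)) w := by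
  induction v generalizing g with
  | nil => simp [liftPath, ← FreeGroup.one_eq_mk]
  | cons d v ih =>
    obtain ⟨i, b⟩ := d
    have hmk : FreeGroup.mk ((i, b) :: v) = FreeGroup.mk [(i, b)] * FreeGroup.mk v := by simp
    cases b
    · have hi : FreeGroup.mk [(i, false)] = (FreeGroup.of i)⁻¹ := by
        rw [FreeGroup.of, FreeGroup.inv_mk]; rfl
      rw [List.cons_append, liftPath, liftPath, ih, hmk, hi, map_mul, map_inv, mul_assoc]
      rfl
    · have hi : FreeGroup.mk [(i, true)] = FreeGroup.of i := rfl
      rw [List.cons_append, liftPath, liftPath, ih, hmk, hi, map_mul, mul_assoc]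
      rfl

theorem pathChain_liftPath_eq_of_red {v w : List (Fin n × Bool)} (h : FreeGroup.Red v w) (g : G) :
    pathChain (liftPath φ g v) = pathChain (liftPath φ g w) := by
  induction h with
  | refl => rfl
  | tail _ hstep ih =>
    rw [ih]
    cases hstep with
    | @not L₁ L₂ i b =>
      rw [liftPath_append, liftPath_append, pathChain_append, pathChain_append]
      congr 1
      cases b <;> simp [liftPath, pathChain]

/-- The 1-chain of the lift, starting at the vertex `g`, of the loop `γ`. -/
noncomputable def liftChain (g : G) (γ : FreeGroup (Fin n)) : (G × Fin n) →₀ ℂ :=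
  pathChain (liftPath φ g γ.toWord)

theorem liftChain_mk (g : G) (w : List (Fin n × Bool)) :
    liftChain φ g (FreeGroup.mk w) = pathChain (liftPath φ g w) := by
  rw [liftChain, FreeGroup.toWord_mk]
  exact (pathChain_liftPath_eq_of_red φ FreeGroup.reduce.red g).symm

@[simp] theorem liftChain_one (g : G) : liftChain φ g 1 = 0 := by
  simp [liftChain, liftPath, pathChain]

theorem liftChain_mul (g : G) (x y : FreeGroup (Fin n)) :
    liftChain φ g (x * y) = liftChain φ g x + liftChain φ (g * φ x) y := by
  rw [← FreeGroup.mk_toWord (x := x), ← FreeGroup.mk_toWord (x := y), FreeGroup.mul_mk,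
    liftChain_mk, liftChain_mk, liftChain_mk, liftPath_append, pathChain_append]

theorem liftChain_of (g : G) (i : Fin n) :
    liftChain φ g (FreeGroup.of i) = Finsupp.single (g, i) 1 := by
  rw [FreeGroup.of, liftChain_mk]
  simp [liftPath, pathChain]

theorem liftChain_inv (g : G) (x : FreeGroup (Fin n)) :
    liftChain φ g x⁻¹ = -liftChain φ (g * (φ x)⁻¹) x := by
  have h := liftChain_mul φ (g * (φ x)⁻¹) x x⁻¹
  rw [mul_inv_cancel, liftChain_one, inv_mul_cancel_right] at h
  exact (neg_eq_of_add_eq_zero_right h.symm).symm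

theorem liftChain_pow (g : G) (x : FreeGroup (Fin n)) (k : ℕ) :
    liftChain φ g (x ^ k) = ∑ j ∈ Finset.range k, liftChain φ (g * φ x ^ j) x := by
  induction k with
  | zero => simp
  | succ k ih => rw [pow_succ, liftChain_mul, ih, Finset.sum_range_succ, map_pow]

theorem elevation_eq_liftChain (g : G) (γ : FreeGroup (Fin n)) :
    elevation φ g γ = liftChain φ g (γ ^ orderOf (φ γ)) := rfl

theorem boundary_liftChain (g : G) (x : FreeGroup (Fin n)) :
    (coverGraph φ).boundary (liftChain φ g x) =
      Finsupp.single (g * φ x) 1 - Finsupp.single g 1 := by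
  have hof (g : G) (i : Fin n) : (coverGraph φ).boundary (liftChain φ g (FreeGroup.of i)) =
      Finsupp.single (g * φ (FreeGroup.of i)) 1 - Finsupp.single g 1 := by
    simp [liftChain_of, OrientedGraph.boundary, coverGraph]
  induction x using FreeGroup.induction_on generalizing g with
  | C1 => simp
  | of i => exact hof g i
  | inv_of i _ =>
    rw [liftChain_inv, map_neg, hof, map_inv, inv_mul_cancel_right, neg_sub]
  | mul x y hx hy => rw [liftChain_mul, map_add, hx, hy, map_mul, mul_assoc]; abel

theorem H1prim_le_H1 : H1prim φ ≤ (coverGraph φ).H1 := by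
  rw [H1prim, Submodule.span_le]
  rintro _ ⟨γ, -, g, rfl⟩
  rw [SetLike.mem_coe, OrientedGraph.H1, LinearMap.mem_ker, elevation_eq_liftChain,
    boundary_liftChain, map_pow, pow_orderOf_eq_one, mul_one, sub_self]

/-! ### Representations without vectors fixed by primitive elements -/

variable {V : Type*} [AddCommGroup V] [Module ℂ V] (ρ : Representation ℂ G V)

/-- No primitive element of the free group fixes a nonzero vector of the representation `ρ`. -/
def PrimitiveFixesNoVector : Prop :=
  ∀ γ : FreeGroup (Fin n), IsPrimitive γ → ∀ v : V, ρ (φ γ) v = v → v = 0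

/-- The `G`-equivariant `V`-valued functional on the 1-chains of the cover that takes the value
`u i` on the edge `(1, i)`. -/
noncomputable def equivariantFunctional (u : Fin n → V) : ((G × Fin n) →₀ ℂ) →ₗ[ℂ] V :=
  Finsupp.linearCombination ℂ fun e => ρ e.1 (u e.2)

theorem equivariantFunctional_liftChain (u : Fin n → V) (g h : G) (x : FreeGroup (Fin n)) :
    equivariantFunctional ρ u (liftChain φ (g * h) x) =
      ρ g (equivariantFunctional ρ u (liftChain φ h x)) := by
  have hof (h : G) (i : Fin n) :
      equivariantFunctional ρ u (liftChain φ (g * h) (FreeGroup.of i)) =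
        ρ g (equivariantFunctional ρ u (liftChain φ h (FreeGroup.of i))) := by
    simp [liftChain_of, equivariantFunctional]
  induction x using FreeGroup.induction_on generalizing h with
  | C1 => simp
  | of i => exact hof h i
  | inv_of i _ => rw [liftChain_inv, liftChain_inv, map_neg, map_neg, map_neg, mul_assoc, hof]
  | mul x y hx hy =>
    rw [liftChain_mul, liftChain_mul, map_add, map_add, map_add, hx, mul_assoc, hy]

/-- An equivariant functional sends the elevation of `γ` at `g` to the translate by `g` of a sum
over the powers of `φ γ`, hence of a vector fixed by `φ γ`. -/
theorem PrimitiveFixesNoVector.equivariantFunctional_elevation {φ : FreeGroup (Fin n) →* G}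
    {ρ : Representation ℂ G V} (h : PrimitiveFixesNoVector φ ρ) (u : Fin n → V) (g : G)
    {γ : FreeGroup (Fin n)} (hγ : IsPrimitive γ) :
    equivariantFunctional ρ u (elevation φ g γ) = 0 := by
  rw [elevation_eq_liftChain, liftChain_pow, map_sum]
  set d := equivariantFunctional ρ u (liftChain φ 1 γ)
  have hterm (j : ℕ) : equivariantFunctional ρ u (liftChain φ (g * φ γ ^ j) γ) =
      ρ g ((ρ (φ γ) ^ j) d) := by
    rw [← mul_one (g * φ γ ^ j), equivariantFunctional_liftChain, map_mul, map_pow]; rfl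
  simp_rw [hterm]
  rw [← map_sum]
  have hfix : ∑ j ∈ Finset.range (orderOf (φ γ)), (ρ (φ γ) ^ j) d = 0 := by
    apply h γ hγ
    have hk : (ρ (φ γ) ^ orderOf (φ γ)) d = d := by
      rw [← map_pow, pow_orderOf_eq_one, map_one]; rfl
    have h1 := Finset.sum_range_succ (fun j => (ρ (φ γ) ^ j) d) (orderOf (φ γ))
    rw [Finset.sum_range_succ', hk, pow_zero] at h1
    rw [map_sum]
    have h2 := add_right_cancel h1
    rw [← h2]
    exact Finset.sum_congr rfl fun j _ => by rw [pow_succ']; rfl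
  rw [hfix, map_zero]

end Cover

theorem isPrimitive_of {n : ℕ} (i : Fin n) : IsPrimitive (FreeGroup.of i) :=
  ⟨FreeGroupBasis.ofFreeGroup (Fin n), i, rfl⟩

section Criterion

variable {G : Type*} [Group G] {φ : FreeGroup (Fin 2) →* G}

/-- A functional that vanishes on all 1-cycles factors through the boundary map. For the equivariant
functional with values `0` on the `a`-edge and `u` on the `b`-edge at `1`, averaging the factor over
`G` would give a vector `w` with `ρ(φ a) w - w = 0` and `ρ(φ b) w - w` a nonzero multiple of `u`;
the former forces `w = 0`. -/
theorem PrimitiveFixesNoVector.H1prim_lt_H1 [Finite G] {V : Type*} [AddCommGroup V] [Module ℂ V]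
    [Nontrivial V] {ρ : Representation ℂ G V} (h : PrimitiveFixesNoVector φ ρ) :
    H1prim φ < (coverGraph φ).H1 := by
  refine lt_of_le_of_ne (H1prim_le_H1 φ) fun heq => ?_
  obtain ⟨u, hu⟩ := exists_ne (0 : V)
  set T := equivariantFunctional ρ ![0, u] with hT
  have hker : LinearMap.ker (coverGraph φ).boundary ≤ LinearMap.ker T := by
    change (coverGraph φ).H1 ≤ _
    rw [← heq, H1prim, Submodule.span_le]
    rintro _ ⟨γ, hγ, g, rfl⟩
    exact h.equivariantFunctional_elevation _ g hγ
  obtain ⟨S, hS⟩ := LinearMap.exists_extend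
    ((LinearMap.ker (coverGraph φ).boundary).liftQ T hker ∘ₗ
      (coverGraph φ).boundary.quotKerEquivRange.symm.toLinearMap)
  have hS' (g : G) (i : Fin 2) : S (Finsupp.single (g * φ (FreeGroup.of i)) 1) -
      S (Finsupp.single g 1) = ρ g (![0, u] i) := by
    have h1 := LinearMap.congr_fun hS
      ⟨(coverGraph φ).boundary (liftChain φ g (FreeGroup.of i)), LinearMap.mem_range_self _ _⟩
    rw [LinearMap.comp_apply, LinearMap.comp_apply, LinearEquiv.coe_coe,
      LinearMap.quotKerEquivRange_symm_apply_image, Submodule.mkQ_apply,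
      Submodule.liftQ_apply] at h1
    change S ((coverGraph φ).boundary (liftChain φ g (FreeGroup.of i))) = _ at h1
    rw [boundary_liftChain, map_sub] at h1
    rw [h1, hT, liftChain_of, equivariantFunctional]
    simp
  have := Fintype.ofFinite G
  set w := ∑ g : G, ρ g⁻¹ (S (Finsupp.single g 1)) with hw
  have hwi (i : Fin 2) : ρ (φ (FreeGroup.of i)) w - w = (Fintype.card G : ℂ) • ![0, u] i := by
    have h1 : ρ (φ (FreeGroup.of i)) w =
        ∑ g : G, ρ g⁻¹ (S (Finsupp.single (g * φ (FreeGroup.of i)) 1)) := by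
      rw [hw, map_sum, ← Equiv.sum_comp (Equiv.mulRight (φ (FreeGroup.of i)))]
      refine Finset.sum_congr rfl fun g _ => ?_
      rw [← Module.End.mul_apply, ← map_mul, Equiv.coe_mulRight, mul_inv_rev,
        mul_inv_cancel_left]
    rw [h1, hw, ← Finset.sum_sub_distrib]
    have h2 (g : G) : ρ g⁻¹ (S (Finsupp.single (g * φ (FreeGroup.of i)) 1)) -
        ρ g⁻¹ (S (Finsupp.single g 1)) = ![0, u] i := by
      rw [← map_sub, hS', ← Module.End.mul_apply, ← map_mul, inv_mul_cancel, map_one]; rfl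
    simp_rw [h2]
    rw [Finset.sum_const, Finset.card_univ, Nat.cast_smul_eq_nsmul]
  have hw0 : w = 0 := by
    refine h _ (isPrimitive_of 0) w ?_
    have := hwi 0
    simpa [sub_eq_zero] using this
  have := hwi 1
  rw [hw0, map_zero, sub_zero, eq_comm, smul_eq_zero] at this
  exact this.elim (Nat.cast_ne_zero.2 Fintype.card_ne_zero) hu

theorem cls_notMem_IrrPr {V : IrrRep G} (h : PrimitiveFixesNoVector φ V.rep) :
    V.cls ∉ IrrPr φ := by
  rintro ⟨W, hW, γ, hγ, w, hw, hfix⟩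
  obtain ⟨e⟩ : Nonempty (W.rep.Equiv V.rep) := Quotient.exact hW
  have h1 : e w = 0 := by
    apply h γ hγ
    have h2 := Representation.IntertwiningMap.isIntertwining _ _ e.toIntertwiningMap (φ γ) w
    rw [hfix] at h2
    exact h2.symm
  exact hw ((map_eq_zero_iff e (EquivLike.injective e)).1 h1)

theorem PrimitiveFixesNoVector.exists_coordinates {V : Type*} [AddCommGroup V] [Module ℂ V]
    [FiniteDimensional ℂ V] {ρ : Representation ℂ G V} (h : PrimitiveFixesNoVector φ ρ) :
    ∃ σ : Representation ℂ G (Fin (Module.finrank ℂ V) → ℂ), PrimitiveFixesNoVector φ σ := by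
  let e := (Module.finBasis ℂ V).equivFun
  refine ⟨(e.conjRingEquiv : _ →* _).comp ρ, fun γ hγ v hv => ?_⟩
  have h1 : e (ρ (φ γ) (e.symm v)) = v := hv
  have h2 := h γ hγ (e.symm v) (e.injective (by rw [h1, e.apply_symm_apply]))
  simpa using h2

theorem PrimitiveFixesNoVector.exists_irrRep {d : ℕ} (hd : d ≠ 0)
    {ρ : Representation ℂ G (Fin d → ℂ)} (h : PrimitiveFixesNoVector φ ρ) :
    ∃ W : IrrRep G, PrimitiveFixesNoVector φ W.rep := by
  induction d using Nat.strong_induction_on with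
  | _ d ih =>
    by_cases hirr : ρ.IsIrreducible
    · exact ⟨⟨d, ρ, hirr⟩, h⟩
    have : Nonempty (Fin d) := ⟨⟨0, Nat.pos_of_ne_zero hd⟩⟩
    obtain ⟨τ, hbot, htop⟩ : ∃ τ : Subrepresentation ρ, τ ≠ ⊥ ∧ τ ≠ ⊤ := by
      by_contra! hcon
      have : Nontrivial (Subrepresentation ρ) :=
        ⟨⊥, ⊤, fun hbt => bot_ne_top (congrArg Subrepresentation.toSubmodule hbt)⟩
      exact hirr ⟨fun τ => or_iff_not_imp_left.2 (hcon τ)⟩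
    have hbot' : τ.toSubmodule ≠ ⊥ := fun hτ => hbot (Subrepresentation.toSubmodule_injective hτ)
    have htop' : τ.toSubmodule ≠ ⊤ := fun hτ => htop (Subrepresentation.toSubmodule_injective hτ)
    have hτ : PrimitiveFixesNoVector φ τ.toRepresentation := fun γ hγ v hv =>
      Subtype.ext (h γ hγ v (congrArg Subtype.val hv))
    obtain ⟨σ, hσ⟩ := hτ.exists_coordinates
    have hlt := Submodule.finrank_lt htop'
    rw [Module.finrank_fin_fun] at hlt
    exact ih _ hlt (mt Submodule.finrank_eq_zero.1 hbot') hσ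

/-- A nonzero finite-dimensional representation in which primitive elements fix no vector contains
an irreducible one with the same property. -/
theorem PrimitiveFixesNoVector.IrrPr_ssubset_univ {V : Type*} [AddCommGroup V] [Module ℂ V]
    [Nontrivial V] [FiniteDimensional ℂ V] {ρ : Representation ℂ G V}
    (h : PrimitiveFixesNoVector φ ρ) : IrrPr φ ⊂ Set.univ := by
  obtain ⟨σ, hσ⟩ := h.exists_coordinates
  obtain ⟨W, hW⟩ := hσ.exists_irrRep Module.finrank_pos.ne'
  exact Set.ssubset_univ_iff.2 fun hu => cls_notMem_IrrPr hW (hu ▸ Set.mem_univ _)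

end Criterion

/-! ### The quaternion group -/

/-- The quaternion units as matrices over the Gaussian integers, where identities in a finite group
can be decided by computation. -/
def quaternionMatrix : QuaternionGroup 2 → Matrix (Fin 2) (Fin 2) GaussianInt
  | .a i => !![⟨0, 1⟩, 0; 0, ⟨0, -1⟩] ^ i.val
  | .xa i => !![0, 1; -1, 0] * !![⟨0, 1⟩, 0; 0, ⟨0, -1⟩] ^ i.val

theorem quaternionMatrix_mul (x y : QuaternionGroup 2) :
    quaternionMatrix (x * y) = quaternionMatrix x * quaternionMatrix y := by
  cases x <;> cases y <;> rename_i i j <;> revert i j <;> decide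

/-- The two-dimensional irreducible representation of the quaternion group. -/
noncomputable def quaternionRep : Representation ℂ (QuaternionGroup 2) (Fin 2 → ℂ) where
  toFun x := Matrix.toLin' ((quaternionMatrix x).map GaussianInt.toComplex)
  map_one' := by
    have h : quaternionMatrix 1 = 1 := by decide
    rw [h, Matrix.map_one _ (map_zero _) (map_one _), Matrix.toLin'_one]
    rfl
  map_mul' x y := by
    rw [quaternionMatrix_mul, Matrix.map_mul, Matrix.toLin'_mul]
    rfl

theorem quaternionRep_a_one :
    quaternionRep (.a 1) = Matrix.toLin' !![Complex.I, 0; 0, -Complex.I] := by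
  have h : quaternionMatrix (.a 1) = !![⟨0, 1⟩, 0; 0, ⟨0, -1⟩] := by decide
  change Matrix.toLin' ((quaternionMatrix (.a 1)).map GaussianInt.toComplex) = _
  rw [h]
  congr 1
  ext i j
  fin_cases i <;> fin_cases j <;> simp [GaussianInt.toComplex_def]

theorem quaternionRep_xa_zero :
    quaternionRep (.xa 0) = Matrix.toLin' !![0, 1; -1, 0] := by
  have h : quaternionMatrix (.xa 0) = !![0, 1; -1, 0] := by decide
  change Matrix.toLin' ((quaternionMatrix (.xa 0)).map GaussianInt.toComplex) = _
  rw [h]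
  congr 1
  ext i j
  fin_cases i <;> fin_cases j <;> simp

theorem quaternionRep_a_two (v : Fin 2 → ℂ) : quaternionRep (.a 2) v = -v := by
  have h : quaternionMatrix (.a 2) = -1 := by decide
  change Matrix.toLin' ((quaternionMatrix (.a 2)).map GaussianInt.toComplex) v = _
  have h2 : (-1 : Matrix (Fin 2) (Fin 2) GaussianInt).map GaussianInt.toComplex = -1 := by
    ext i j
    fin_cases i <;> fin_cases j <;> simp
  rw [h, h2]
  simp

/-- The quaternion group acts freely on `ℂ² \ {0}`, because every nontrivial element has the
central element `-1` among its powers. -/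
theorem eq_zero_of_quaternionRep_apply_eq {q : QuaternionGroup 2} (hq : q ≠ 1) {v : Fin 2 → ℂ}
    (hv : quaternionRep q v = v) : v = 0 := by
  have h : q = .a 2 ∨ q * q = .a 2 := by
    clear hv
    revert hq
    cases q <;> rename_i i <;> revert i <;> decide
  have h2 : quaternionRep (.a 2) v = v := by
    rcases h with h | h
    · rw [← h, hv]
    · rw [← h, map_mul, Module.End.mul_apply, hv, hv]
  rw [quaternionRep_a_two] at h2
  exact self_eq_neg.1 h2.symm

/-- The surjection from the free group onto the quaternion group with `a ↦ i` and `b ↦ j`. -/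
def quaternionHom : FreeGroup (Fin 2) →* QuaternionGroup 2 :=
  FreeGroup.lift ![.a 1, .xa 0]

@[simp] theorem quaternionHom_genA : quaternionHom genA = .a 1 := by simp [quaternionHom, genA]

@[simp] theorem quaternionHom_genB : quaternionHom genB = .xa 0 := by simp [quaternionHom, genB]

theorem quaternionHom_ne_one {x : FreeGroup (Fin 2)} (hx : IsPrimitive x) :
    quaternionHom x ≠ 1 := by
  intro h
  have := hx.commute quaternionHom h genA genB
  rw [quaternionHom_genA, quaternionHom_genB] at this
  revert this
  unfold Commute SemiconjBy
  decide

/-- A submodule of `ℂ²` that contains a nonzero vector and is invariant under `diag(i, -i)` and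
under a quarter turn is everything: the first matrix splits off the coordinates of the vector, and
the second one exchanges the two axes. -/
theorem isIrreducible_of_quaternion {G : Type*} [Group G] {ρ : Representation ℂ G (Fin 2 → ℂ)}
    {g h : G} (hg : ρ g = Matrix.toLin' !![Complex.I, 0; 0, -Complex.I])
    (hh : ρ h = Matrix.toLin' !![0, 1; -1, 0]) : ρ.IsIrreducible := by
  have : Nontrivial (Subrepresentation ρ) :=
    ⟨⊥, ⊤, fun hbt => bot_ne_top (congrArg Subrepresentation.toSubmodule hbt)⟩
  refine ⟨fun τ => or_iff_not_imp_left.2 fun hτ => ?_⟩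
  apply Subrepresentation.toSubmodule_injective
  change τ.toSubmodule = ⊤
  obtain ⟨v, hv, hv0⟩ := (Submodule.ne_bot_iff _).1
    fun h' : τ.toSubmodule = ⊥ => hτ (Subrepresentation.toSubmodule_injective h')
  have hI (w : Fin 2 → ℂ) (hw : w ∈ τ.toSubmodule) :
      ![Complex.I * w 0, -(Complex.I * w 1)] ∈ τ.toSubmodule := by
    have h1 := τ.apply_mem_toSubmodule g hw
    rw [hg, Matrix.toLin'_apply] at h1
    convert h1 using 1
    ext t
    fin_cases t <;> simp [Matrix.mulVec, dotProduct]
  have hJ (w : Fin 2 → ℂ) (hw : w ∈ τ.toSubmodule) : ![w 1, -w 0] ∈ τ.toSubmodule := by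
    have h1 := τ.apply_mem_toSubmodule h hw
    rw [hh, Matrix.toLin'_apply] at h1
    convert h1 using 1
    ext t
    fin_cases t <;> simp [Matrix.mulVec, dotProduct]
  have hfst (w : Fin 2 → ℂ) (hw : w ∈ τ.toSubmodule) (hw0 : w 0 ≠ 0) : τ.toSubmodule = ⊤ := by
    have h1 : ![(1 : ℂ), 0] ∈ τ.toSubmodule := by
      have h2 := τ.toSubmodule.smul_mem (2 * w 0)⁻¹
        (τ.toSubmodule.sub_mem hw (τ.toSubmodule.smul_mem Complex.I (hI w hw)))
      convert h2 using 1
      ext t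
      fin_cases t
      · simp [← mul_assoc, Matrix.vecHead]
        field_simp
        norm_num
      · simp [← mul_assoc, Matrix.vecHead, Matrix.vecTail]
    have h2 : ![(0 : ℂ), -1] ∈ τ.toSubmodule := by simpa using hJ _ h1
    rw [eq_top_iff]
    rintro u -
    convert τ.toSubmodule.sub_mem (τ.toSubmodule.smul_mem (u 0) h1)
      (τ.toSubmodule.smul_mem (u 1) h2) using 1
    ext t
    fin_cases t <;> simp
  by_cases h0 : v 0 = 0
  · refine hfst _ (hJ v hv) fun h1 => hv0 ?_
    ext t
    fin_cases t
    · exact h0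
    · exact h1
  · exact hfst v hv h0

/-- Any group through which the surjection onto the quaternion group factors inherits the
quaternion representation. -/
theorem primitiveFixesNoVector_quaternion {G : Type*} [Group G] {φ : FreeGroup (Fin 2) →* G}
    {f : G →* QuaternionGroup 2} (hf : f.comp φ = quaternionHom) :
    PrimitiveFixesNoVector φ (quaternionRep.comp f) := fun γ hγ v hv => by
  refine eq_zero_of_quaternionRep_apply_eq (quaternionHom_ne_one hγ) (v := v) ?_
  rw [← hf]
  exact hv

/-! ### Homomorphisms from free, presented and cyclic groups -/

/-- A predicate that holds at `1` and is stable under left multiplication by the generators and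
their inverses holds on the free group. -/
theorem freeGroup_induction_left {P : FreeGroup (Fin 2) → Prop} (one : P 1)
    (mulA : ∀ y, P y → P (genA * y)) (invA : ∀ y, P y → P (genA⁻¹ * y))
    (mulB : ∀ y, P y → P (genB * y)) (invB : ∀ y, P y → P (genB⁻¹ * y)) (x) : P x := by
  have hx : x ∈ Subgroup.closure (Set.range (FreeGroup.of : Fin 2 → _)) := by
    rw [FreeGroup.closure_range_of]; trivial
  induction hx using Subgroup.closure_induction_left with
  | one => exact one
  | mul_left z hz y _ hy =>
    obtain ⟨i, rfl⟩ := hz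
    fin_cases i
    · exact mulA y hy
    · exact mulB y hy
  | inv_mul_cancel z hz y _ hy =>
    obtain ⟨i, rfl⟩ := hz
    fin_cases i
    · exact invA y hy
    · exact invB y hy

theorem exists_hom_comp_mk_eq {α H : Type*} [Group H] {rels : Set (FreeGroup α)}
    (f : FreeGroup α →* H) (hf : ∀ r ∈ rels, f r = 1) :
    ∃ g : PresentedGroup rels →* H, g.comp (PresentedGroup.mk rels) = f := by
  have hker : Subgroup.normalClosure rels ≤ f.ker := Subgroup.normalClosure_le_normal hf
  exact ⟨QuotientGroup.lift _ f hker, MonoidHom.ext fun _ => rfl⟩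

/-- The homomorphism from a cyclic group of order `n` given by an element with `g ^ n = 1`. -/
def cyclicHom {H : Type*} [Group H] (n : ℕ) (g : H) (hg : g ^ n = 1) :
    Multiplicative (ZMod n) →* H :=
  AddMonoidHom.toMultiplicativeLeft
    (ZMod.lift n ⟨zmultiplesHom (Additive H) (Additive.ofMul g), by
      rw [zmultiplesHom_apply, natCast_zsmul, ← ofMul_pow, hg]; rfl⟩)

theorem cyclicHom_ofAdd_intCast {H : Type*} [Group H] (n : ℕ) (g : H) (hg : g ^ n = 1) (k : ℤ) :
    cyclicHom n g hg (Multiplicative.ofAdd (k : ZMod n)) = g ^ k := by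
  change Additive.toMul (ZMod.lift n _ (k : ZMod n)) = _
  rw [ZMod.lift_coe]
  rfl

theorem modHomology_genA (m : ℕ) :
    modHomology 2 m genA = Multiplicative.ofAdd (Pi.single 0 1) := by
  simp [modHomology, genA]

theorem modHomology_genB (m : ℕ) :
    modHomology 2 m genB = Multiplicative.ofAdd (Pi.single 1 1) := by
  simp [modHomology, genB]

/-! ### The two-step nilpotent group of order 32 -/

namespace NilGroup

/-- The image of `a` in the presented group. -/
def a : PresentedGroup nilRels := PresentedGroup.mk nilRels genA

/-- The image of `b` in the presented group. -/
def b : PresentedGroup nilRels := PresentedGroup.mk nilRels genB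

/-- The image of `[a, b]` in the presented group. -/
def c : PresentedGroup nilRels := PresentedGroup.mk nilRels genC

theorem c_eq : c = a * b * a⁻¹ * b⁻¹ := rfl

theorem a_pow_four : a ^ 4 = 1 := PresentedGroup.one_of_mem (x := genA ^ 4) (by simp [nilRels])

theorem b_pow_four : b ^ 4 = 1 := PresentedGroup.one_of_mem (x := genB ^ 4) (by simp [nilRels])

theorem c_sq : c ^ 2 = 1 := PresentedGroup.one_of_mem (x := genC ^ 2) (by simp [nilRels])

theorem commute_c_a : Commute c a := by
  have h : c * a * c⁻¹ * a⁻¹ = 1 :=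
    PresentedGroup.one_of_mem (x := genC * genA * genC⁻¹ * genA⁻¹) (by simp [nilRels])
  exact mul_inv_eq_iff_eq_mul.1 (mul_inv_eq_one.1 h)

theorem commute_c_b : Commute c b := by
  have h : c * b * c⁻¹ * b⁻¹ = 1 :=
    PresentedGroup.one_of_mem (x := genC * genB * genC⁻¹ * genB⁻¹) (by simp [nilRels])
  exact mul_inv_eq_iff_eq_mul.1 (mul_inv_eq_one.1 h)

theorem exists_projection : ∃ π : PresentedGroup nilRels →* Multiplicative (Fin 2 → ZMod 4),
    π.comp (PresentedGroup.mk nilRels) = modHomology 2 4 := by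
  refine exists_hom_comp_mk_eq _ fun r hr => ?_
  simp only [nilRels, Set.mem_insert_iff, Set.mem_singleton_iff] at hr
  rcases hr with rfl | rfl | rfl | rfl | rfl <;>
  · simp only [genC, map_mul, map_pow, map_inv, modHomology_genA, modHomology_genB]
    decide

theorem exists_quaternion : ∃ f : PresentedGroup nilRels →* QuaternionGroup 2,
    f.comp (PresentedGroup.mk nilRels) = quaternionHom := by
  refine exists_hom_comp_mk_eq _ fun r hr => ?_
  simp only [nilRels, Set.mem_insert_iff, Set.mem_singleton_iff] at hr
  rcases hr with rfl | rfl | rfl | rfl | rfl <;>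
  · simp only [genC, map_mul, map_pow, map_inv, quaternionHom_genA, quaternionHom_genB]
    decide

theorem c_ne_one : c ≠ 1 := by
  obtain ⟨f, hf⟩ := exists_quaternion
  intro h
  have h1 := congrArg f h
  change (f.comp (PresentedGroup.mk nilRels)) genC = _ at h1
  rw [hf, map_one] at h1
  simp only [genC, map_mul, map_inv, quaternionHom_genA, quaternionHom_genB] at h1
  revert h1
  decide

theorem orderOf_c : orderOf c = 2 := orderOf_eq_prime c_sq c_ne_one

theorem b_mul_a_zpow (i : ℤ) : b * a ^ i = a ^ i * b * c ^ (-i) := by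
  have h : b * a * b⁻¹ = a * c⁻¹ := by
    rw [← commute_c_a.inv_left.eq, c_eq]; group
  have h1 : b * a ^ i * b⁻¹ = a ^ i * c ^ (-i) := by
    rw [← conj_zpow, h, (commute_c_a.inv_left.symm).mul_zpow, inv_zpow']
  rw [mul_assoc (a ^ i), (commute_c_b.zpow_left (-i)).eq.symm, ← mul_assoc, ← h1,
    inv_mul_cancel_right]

theorem b_inv_mul_a_zpow (i : ℤ) : b⁻¹ * a ^ i = a ^ i * b⁻¹ * c ^ i := by
  have h := b_mul_a_zpow i
  rw [inv_mul_eq_iff_eq_mul, ← mul_assoc, ← mul_assoc, h, mul_assoc (a ^ i * b),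
    ((commute_c_b.inv_right).zpow_left (-i)).eq]
  group

/-- The normal form of the elements of the group. -/
theorem exists_eq_zpow_mul (g : PresentedGroup nilRels) :
    ∃ i j k : ℤ, g = a ^ i * b ^ j * c ^ k := by
  obtain ⟨x, rfl⟩ := PresentedGroup.mk_surjective nilRels g
  induction x using freeGroup_induction_left with
  | one => exact ⟨0, 0, 0, by simp⟩
  | mulA y hy =>
    obtain ⟨i, j, k, h⟩ := hy
    refine ⟨1 + i, j, k, ?_⟩
    rw [map_mul, h, zpow_add, zpow_one, mul_assoc, mul_assoc, mul_assoc]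
    rfl
  | invA y hy =>
    obtain ⟨i, j, k, h⟩ := hy
    refine ⟨-1 + i, j, k, ?_⟩
    rw [map_mul, map_inv, h, zpow_add, zpow_neg_one, mul_assoc, mul_assoc, mul_assoc]
    rfl
  | mulB y hy =>
    obtain ⟨i, j, k, h⟩ := hy
    refine ⟨i, 1 + j, -i + k, ?_⟩
    rw [map_mul, h]
    change b * (a ^ i * b ^ j * c ^ k) = _
    rw [← mul_assoc, ← mul_assoc, b_mul_a_zpow, mul_assoc (a ^ i * b),
      (commute_c_b.zpow_zpow (-i) j).eq, zpow_add, zpow_one, zpow_add]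
    simp only [mul_assoc]
  | invB y hy =>
    obtain ⟨i, j, k, h⟩ := hy
    refine ⟨i, -1 + j, i + k, ?_⟩
    rw [map_mul, map_inv, h]
    change b⁻¹ * (a ^ i * b ^ j * c ^ k) = _
    rw [← mul_assoc, ← mul_assoc, b_inv_mul_a_zpow, mul_assoc (a ^ i * b⁻¹),
      (commute_c_b.zpow_zpow i j).eq, zpow_add, zpow_neg_one, zpow_add]
    simp only [mul_assoc]

section Projection

variable {π : PresentedGroup nilRels →* Multiplicative (Fin 2 → ZMod 4)}
  (hπ : π.comp (PresentedGroup.mk nilRels) = modHomology 2 4)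

include hπ

theorem projection_apply (i j k : ℤ) :
    π (a ^ i * b ^ j * c ^ k) = Multiplicative.ofAdd ![(i : ZMod 4), (j : ZMod 4)] := by
  have ha : π a = Multiplicative.ofAdd (Pi.single 0 1) := by
    rw [← modHomology_genA, ← hπ]; rfl
  have hb : π b = Multiplicative.ofAdd (Pi.single 1 1) := by
    rw [← modHomology_genB, ← hπ]; rfl
  have hc : π c = 1 := by rw [c_eq, map_mul, map_mul, map_mul, map_inv, map_inv, mul_right_comm]; simp
  rw [map_mul, map_mul, map_zpow, map_zpow, map_zpow, ha, hb, hc, one_zpow, mul_one, ← ofAdd_zsmul,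
    ← ofAdd_zsmul, ← ofAdd_add]
  congr 1
  ext t
  fin_cases t <;> simp

theorem projection_surjective : Function.Surjective π := by
  intro q
  refine ⟨a ^ ((q.toAdd 0).val : ℤ) * b ^ ((q.toAdd 1).val : ℤ) * c ^ (0 : ℤ), ?_⟩
  rw [projection_apply hπ]
  apply Multiplicative.toAdd.injective
  ext t
  fin_cases t <;> simp

theorem ker_projection : π.ker = Subgroup.zpowers c := by
  apply le_antisymm
  · intro g hg
    obtain ⟨i, j, k, rfl⟩ := exists_eq_zpow_mul g
    rw [MonoidHom.mem_ker, projection_apply hπ] at hg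
    have h0 := congrFun (Multiplicative.ofAdd.injective hg) 0
    have h1 := congrFun (Multiplicative.ofAdd.injective hg) 1
    obtain ⟨m, rfl⟩ := (ZMod.intCast_zmod_eq_zero_iff_dvd i 4).1 h0
    obtain ⟨n, rfl⟩ := (ZMod.intCast_zmod_eq_zero_iff_dvd j 4).1 h1
    have ha : a ^ ((4 : ℕ) : ℤ) = 1 := by rw [zpow_natCast, a_pow_four]
    have hb : b ^ ((4 : ℕ) : ℤ) = 1 := by rw [zpow_natCast, b_pow_four]
    rw [zpow_mul, zpow_mul, ha, hb, one_zpow, one_zpow, one_mul, one_mul]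
    exact Subgroup.zpow_mem_zpowers c k
  · rw [Subgroup.zpowers_le]
    have := projection_apply hπ 0 0 1
    rw [zpow_zero, zpow_zero, zpow_one, one_mul, one_mul] at this
    rw [MonoidHom.mem_ker, this]
    decide

theorem ker_projection_le_center : π.ker ≤ Subgroup.center _ := by
  rw [ker_projection hπ, Subgroup.zpowers_le, Subgroup.mem_center_iff]
  intro g
  obtain ⟨i, j, k, rfl⟩ := exists_eq_zpow_mul g
  exact (((commute_c_a.zpow_right i).mul_right (commute_c_b.zpow_right j)).mul_right
    ((Commute.refl c).zpow_right k)).eq.symm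

end Projection

theorem card : Nat.card (PresentedGroup nilRels) = 32 := by
  obtain ⟨π, hπ⟩ := exists_projection
  rw [← π.ker.card_mul_index, Subgroup.index_ker, MonoidHom.range_eq_top.2 (projection_surjective hπ),
    ker_projection hπ, Nat.card_zpowers, orderOf_c, Subgroup.card_top, Nat.card_eq_fintype_card]
  simp

theorem finite : Finite (PresentedGroup nilRels) :=
  Nat.finite_of_card_ne_zero (by rw [card]; decide)

theorem isNilpotent : Group.IsNilpotent (PresentedGroup nilRels) := by
  obtain ⟨π, hπ⟩ := exists_projection
  exact Subgroup.isNilpotent_of_ker_le_center π (ker_projection_le_center hπ)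

theorem nilpotencyClass_eq : Group.nilpotencyClass (PresentedGroup nilRels) = 2 := by
  obtain ⟨π, hπ⟩ := exists_projection
  have := isNilpotent
  apply le_antisymm
  · refine (Group.nilpotencyClass_le_of_ker_le_center π
      (ker_projection_le_center hπ)).trans ?_
    exact Nat.succ_le_succ CommGroup.nilpotencyClass_le_one
  · by_contra! h
    have h1 := Subgroup.upperCentralSeries_eq_top_iff_nilpotencyClass_le.2 (Nat.le_of_lt_succ h)
    rw [Subgroup.upperCentralSeries_one] at h1
    have h2 : b ∈ Subgroup.center _ := h1 ▸ Subgroup.mem_top b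
    apply c_ne_one
    rw [c_eq, Subgroup.mem_center_iff.1 h2 a]
    group

theorem exists_exact_sequence :
    ∃ (ι : Multiplicative (ZMod 2) →* PresentedGroup nilRels)
      (π : PresentedGroup nilRels →* Multiplicative (Fin 2 → ZMod 4)),
      Function.Injective ι ∧ Function.Surjective π ∧ ι.range = π.ker ∧
        π.comp (PresentedGroup.mk nilRels) = modHomology 2 4 := by
  obtain ⟨π, hπ⟩ := exists_projection
  refine ⟨cyclicHom 2 c c_sq, π, ?_, projection_surjective hπ, ?_, hπ⟩
  · rw [injective_iff_map_eq_one]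
    intro x hx
    obtain ⟨k, hk⟩ := ZMod.intCast_surjective x.toAdd
    obtain rfl : x = Multiplicative.ofAdd (k : ZMod 2) := by rw [hk]; rfl
    rw [cyclicHom_ofAdd_intCast, ← orderOf_dvd_iff_zpow_eq_one, orderOf_c] at hx
    rw [(ZMod.intCast_zmod_eq_zero_iff_dvd k 2).2 hx]
    rfl
  · rw [ker_projection hπ]
    ext g
    rw [Subgroup.mem_zpowers_iff, MonoidHom.mem_range]
    constructor
    · rintro ⟨x, rfl⟩
      obtain ⟨k, hk⟩ := ZMod.intCast_surjective x.toAdd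
      refine ⟨k, ?_⟩
      rw [← cyclicHom_ofAdd_intCast 2 c c_sq, hk]
      rfl
    · rintro ⟨k, rfl⟩
      exact ⟨_, cyclicHom_ofAdd_intCast 2 c c_sq k⟩

theorem mk_ne_one {x : FreeGroup (Fin 2)} (hx : IsPrimitive x) :
    PresentedGroup.mk nilRels x ≠ 1 := by
  obtain ⟨f, hf⟩ := exists_quaternion
  intro h
  apply quaternionHom_ne_one hx
  rw [← hf, MonoidHom.comp_apply, h, map_one]

/-- The quaternion representation sends `c` to `-1` and `a ^ 2` to `-1`, so it kills `a ^ 2 * c`,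
which is detected by the mod-4 homology. -/
theorem exists_representation :
    ∃ (ρ : Representation ℂ (PresentedGroup nilRels) (Fin 2 → ℂ)) (hρ : ρ.IsIrreducible),
      ρ (PresentedGroup.mk nilRels genA) =
        Matrix.toLin' !![Complex.I, 0; 0, -Complex.I] ∧
      ρ (PresentedGroup.mk nilRels genB) = Matrix.toLin' !![0, 1; -1, 0] ∧
      (∀ x, IsPrimitive x →
        ¬ Module.End.HasEigenvalue (ρ (PresentedGroup.mk nilRels x)) (1 : ℂ)) ∧
      (IrrRep.mk 2 ρ hρ).cls ∉ IrrPr (PresentedGroup.mk nilRels) ∧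
      PresentedGroup.mk nilRels (genA ^ 2 * genC) ≠ 1 ∧
      ρ (PresentedGroup.mk nilRels (genA ^ 2 * genC)) = 1 := by
  obtain ⟨f, hf⟩ := exists_quaternion
  have hfix := primitiveFixesNoVector_quaternion hf
  have hmk (x : FreeGroup (Fin 2)) : f (PresentedGroup.mk nilRels x) = quaternionHom x := by
    rw [← hf]; rfl
  have hA : quaternionRep.comp f (PresentedGroup.mk nilRels genA) =
      Matrix.toLin' !![Complex.I, 0; 0, -Complex.I] := by
    rw [MonoidHom.comp_apply, hmk, quaternionHom_genA, quaternionRep_a_one]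
  have hB : quaternionRep.comp f (PresentedGroup.mk nilRels genB) =
      Matrix.toLin' !![0, 1; -1, 0] := by
    rw [MonoidHom.comp_apply, hmk, quaternionHom_genB, quaternionRep_xa_zero]
  have hirr := isIrreducible_of_quaternion hA hB
  refine ⟨quaternionRep.comp f, hirr, hA, hB, fun x hx hev => ?_,
    cls_notMem_IrrPr (V := ⟨2, quaternionRep.comp f, hirr⟩) hfix, fun h => ?_, ?_⟩
  · obtain ⟨v, hv⟩ := hev.exists_hasEigenvector
    exact hv.2 (hfix x hx v (by simpa using hv.apply_eq_smul))
  · obtain ⟨π, hπ⟩ := exists_projection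
    have h1 := congrArg π h
    change (π.comp (PresentedGroup.mk nilRels)) (genA ^ 2 * genC) = _ at h1
    rw [hπ, map_one] at h1
    simp only [genC, map_mul, map_pow, map_inv, modHomology_genA, modHomology_genB] at h1
    revert h1
    decide
  · rw [MonoidHom.comp_apply, hmk]
    have h1 : quaternionHom (genA ^ 2 * genC) = 1 := by
      simp only [genC, map_mul, map_pow, map_inv, quaternionHom_genA, quaternionHom_genB]
      decide
    rw [h1, map_one]

theorem IrrPr_ssubset : IrrPr (PresentedGroup.mk nilRels) ⊂ Set.univ := by
  obtain ⟨f, hf⟩ := exists_quaternion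
  exact (primitiveFixesNoVector_quaternion hf).IrrPr_ssubset_univ

theorem H1prim_lt :
    H1prim (PresentedGroup.mk nilRels) < (coverGraph (PresentedGroup.mk nilRels)).H1 := by
  obtain ⟨f, hf⟩ := exists_quaternion
  have := finite
  exact (primitiveFixesNoVector_quaternion hf).H1prim_lt_H1

end NilGroup

/-! ### The group of order 24 acting freely on a sphere -/

namespace SphereGroup

/-- The image of `a` in the presented group. -/
def a : PresentedGroup sphereRels := PresentedGroup.mk sphereRels genA

/-- The image of `b` in the presented group. -/
def b : PresentedGroup sphereRels := PresentedGroup.mk sphereRels genB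

theorem a_pow_three : a ^ 3 = 1 :=
  PresentedGroup.one_of_mem (x := genA ^ 3) (by simp [sphereRels])

theorem b_pow_eight : b ^ 8 = 1 :=
  PresentedGroup.one_of_mem (x := genB ^ 8) (by simp [sphereRels])

theorem semiconjBy_b : SemiconjBy b a a⁻¹ := by
  have h : b * a * b⁻¹ * (a ^ 2)⁻¹ = 1 :=
    PresentedGroup.one_of_mem (x := genB * genA * genB⁻¹ * (genA ^ 2)⁻¹) (by simp [sphereRels])
  have h2 : a ^ 2 = a⁻¹ := eq_inv_of_mul_eq_one_left (by rw [← pow_succ, a_pow_three])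
  rw [← h2]
  exact mul_inv_eq_iff_eq_mul.1 (mul_inv_eq_one.1 h)

theorem commute_b_sq : Commute (b ^ 2) a := by
  have h := semiconjBy_b.inv_right.mul_left semiconjBy_b
  rwa [inv_inv, ← pow_two] at h

theorem exists_projection : ∃ π : PresentedGroup sphereRels →* Multiplicative (ZMod 8),
    π a = 1 ∧ π b = Multiplicative.ofAdd 1 := by
  obtain ⟨π, hπ⟩ := exists_hom_comp_mk_eq (rels := sphereRels)
    (FreeGroup.lift ![(1 : Multiplicative (ZMod 8)), Multiplicative.ofAdd 1]) fun r hr => by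
      simp only [sphereRels, Set.mem_insert_iff, Set.mem_singleton_iff] at hr
      rcases hr with rfl | rfl | rfl <;>
      · simp only [genA, genB, map_mul, map_pow, map_inv, FreeGroup.lift_apply_of]
        decide
  refine ⟨π, ?_, ?_⟩
  · change (π.comp (PresentedGroup.mk sphereRels)) genA = _
    simp [hπ, genA]
  · change (π.comp (PresentedGroup.mk sphereRels)) genB = _
    simp [hπ, genB]

theorem exists_dihedral : ∃ f : PresentedGroup sphereRels →* DihedralGroup 3,
    f a = .r 1 ∧ f b = .sr 0 := by
  obtain ⟨f, hf⟩ := exists_hom_comp_mk_eq (rels := sphereRels)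
    (FreeGroup.lift ![(.r 1 : DihedralGroup 3), .sr 0]) fun r hr => by
      simp only [sphereRels, Set.mem_insert_iff, Set.mem_singleton_iff] at hr
      rcases hr with rfl | rfl | rfl <;>
      · simp only [genA, genB, map_mul, map_pow, map_inv, FreeGroup.lift_apply_of]
        decide
  refine ⟨f, ?_, ?_⟩
  · change (f.comp (PresentedGroup.mk sphereRels)) genA = _
    simp [hf, genA]
  · change (f.comp (PresentedGroup.mk sphereRels)) genB = _
    simp [hf, genB]

theorem not_commute : ¬ Commute a b := by
  intro h
  obtain ⟨f, ha, hb⟩ := exists_dihedral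
  have h1 := h.map f
  rw [ha, hb] at h1
  revert h1
  unfold Commute SemiconjBy
  decide

theorem mk_ne_one {x : FreeGroup (Fin 2)} (hx : IsPrimitive x) :
    PresentedGroup.mk sphereRels x ≠ 1 :=
  fun h => not_commute (hx.commute _ h genA genB)

theorem orderOf_a : orderOf a = 3 :=
  orderOf_eq_prime a_pow_three fun h => not_commute (h ▸ Commute.one_left b)

theorem orderOf_b_dvd : orderOf b ∣ 8 := orderOf_dvd_of_pow_eq_one b_pow_eight

/-- The normal form of the elements of the group. -/
theorem exists_eq_zpow_mul (g : PresentedGroup sphereRels) : ∃ i j : ℤ, g = a ^ i * b ^ j := by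
  obtain ⟨x, rfl⟩ := PresentedGroup.mk_surjective sphereRels g
  induction x using freeGroup_induction_left with
  | one => exact ⟨0, 0, by simp⟩
  | mulA y hy =>
    obtain ⟨i, j, h⟩ := hy
    refine ⟨1 + i, j, ?_⟩
    rw [map_mul, h, zpow_add, zpow_one, mul_assoc]
    rfl
  | invA y hy =>
    obtain ⟨i, j, h⟩ := hy
    refine ⟨-1 + i, j, ?_⟩
    rw [map_mul, map_inv, h, zpow_add, zpow_neg_one, mul_assoc]
    rfl
  | mulB y hy =>
    obtain ⟨i, j, h⟩ := hy
    refine ⟨-i, 1 + j, ?_⟩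
    rw [map_mul, h, zpow_add, zpow_one]
    change b * (a ^ i * b ^ j) = _
    rw [← mul_assoc, ← mul_assoc, (semiconjBy_b.zpow_right i).eq, inv_zpow']
  | invB y hy =>
    obtain ⟨i, j, h⟩ := hy
    refine ⟨-i, -1 + j, ?_⟩
    rw [map_mul, map_inv, h, zpow_add, zpow_neg_one]
    change b⁻¹ * (a ^ i * b ^ j) = _
    have h1 := semiconjBy_b.inv_right.inv_symm_left
    rw [inv_inv] at h1
    rw [← mul_assoc, ← mul_assoc, (h1.zpow_right i).eq, inv_zpow']

theorem card : Nat.card (PresentedGroup sphereRels) = 24 := by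
  obtain ⟨π, ha, hb⟩ := exists_projection
  have hsurj : Function.Surjective π := fun q => by
    obtain ⟨k, hk⟩ := ZMod.intCast_surjective q.toAdd
    refine ⟨b ^ k, ?_⟩
    rw [map_zpow, hb, ← ofAdd_zsmul, zsmul_one, hk]
    rfl
  have hker : π.ker = Subgroup.zpowers a := by
    apply le_antisymm
    · intro g hg
      obtain ⟨i, j, rfl⟩ := exists_eq_zpow_mul g
      rw [MonoidHom.mem_ker, map_mul, map_zpow, map_zpow, ha, hb, one_zpow, one_mul,
        ← ofAdd_zsmul, zsmul_one] at hg
      have h1 := (ZMod.intCast_zmod_eq_zero_iff_dvd j 8).1 hg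
      have hj : b ^ j = 1 :=
        orderOf_dvd_iff_zpow_eq_one.1 ((Int.natCast_dvd_natCast.2 orderOf_b_dvd).trans h1)
      rw [hj, mul_one]
      exact Subgroup.zpow_mem_zpowers a i
    · rw [Subgroup.zpowers_le]
      exact ha
  rw [← π.ker.card_mul_index, Subgroup.index_ker, MonoidHom.range_eq_top.2 hsurj, hker,
    Nat.card_zpowers, orderOf_a, Subgroup.card_top, Nat.card_eq_fintype_card]
  simp

theorem finite : Finite (PresentedGroup sphereRels) :=
  Nat.finite_of_card_ne_zero (by rw [card]; decide)

/-- Every nontrivial element has one of the elements `a` and `b ^ 4` of prime order among its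
powers. -/
theorem exists_zpow_eq {g : PresentedGroup sphereRels} (hg : g ≠ 1) :
    ∃ k : ℤ, g ^ k = a ∨ g ^ k = b ^ 4 := by
  have ha (i : ℤ) (hi : (3 : ℤ) ∣ i) : a ^ i = 1 := by
    rw [← orderOf_dvd_iff_zpow_eq_one, orderOf_a]; exact hi
  have hb (i : ℤ) (hi : (8 : ℤ) ∣ i - 4) : b ^ i = b ^ 4 := by
    have h1 : b ^ (i - 4) = 1 :=
      orderOf_dvd_iff_zpow_eq_one.1 ((Int.natCast_dvd_natCast.2 orderOf_b_dvd).trans hi)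
    rw [zpow_sub, mul_inv_eq_one] at h1
    exact_mod_cast h1
  obtain ⟨i, j, rfl⟩ := exists_eq_zpow_mul g
  rcases Int.even_or_odd' j with ⟨m, rfl | rfl⟩
  · -- `b ^ (2 * m)` is central
    have hcomm : Commute (a ^ i) (b ^ (2 * m)) := by
      rw [zpow_mul]
      exact (commute_b_sq.zpow_zpow m i).symm
    by_cases h8 : (8 : ℤ) ∣ 2 * m
    · have hb1 : b ^ (2 * m) = 1 :=
        orderOf_dvd_iff_zpow_eq_one.1 ((Int.natCast_dvd_natCast.2 orderOf_b_dvd).trans h8)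
      rw [hb1, mul_one] at hg ⊢
      have hi : ¬ (3 : ℤ) ∣ i := fun hi => hg (ha i hi)
      refine ⟨i, Or.inl ?_⟩
      have h1 : (3 : ℤ) ∣ i * i - 1 := by
        rcases (by omega : i % 3 = 1 ∨ i % 3 = 2) with h | h <;>
        · apply Int.dvd_of_emod_eq_zero
          simp [Int.sub_emod, Int.mul_emod, h]
      have h2 := ha _ h1
      rw [zpow_sub, mul_inv_eq_one, zpow_one] at h2
      rw [← zpow_mul, h2]
    · rcases (by omega : (8 : ℤ) ∣ 2 * m * 3 - 4 ∨ (8 : ℤ) ∣ 2 * m * 6 - 4) with h | h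
      · refine ⟨3, Or.inr ?_⟩
        rw [hcomm.mul_zpow, ← zpow_mul, ← zpow_mul, ha _ (by omega), one_mul, hb _ h]
      · refine ⟨6, Or.inr ?_⟩
        rw [hcomm.mul_zpow, ← zpow_mul, ← zpow_mul, ha _ (by omega), one_mul, hb _ h]
  · -- an odd power of `b` inverts `a`, so the square lies in the subgroup generated by `b`
    have hsemi : SemiconjBy (b ^ (2 * m + 1)) (a ^ i) (a ^ (-i)) := by
      rw [zpow_add, zpow_mul, zpow_one, ← inv_zpow']
      have h1 : Commute (b ^ 2) a⁻¹ := commute_b_sq.inv_right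
      exact (SemiconjBy.mul_left (h1.zpow_zpow m 1).semiconjBy
        (by simpa using semiconjBy_b)).zpow_right i
    refine ⟨4, Or.inr ?_⟩
    have hsq : (a ^ i * b ^ (2 * m + 1)) ^ (2 : ℤ) = b ^ (2 * (2 * m + 1)) := by
      rw [zpow_two, mul_assoc, ← mul_assoc (b ^ (2 * m + 1)), hsemi.eq, mul_assoc, ← mul_assoc,
        ← zpow_add, ← zpow_add, add_neg_cancel, zpow_zero, one_mul,
        two_mul (2 * m + 1)]
    rw [show (4 : ℤ) = 2 * 2 by norm_num, zpow_mul, hsq, ← zpow_mul, hb _ (by omega)]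

/-- The matrix of `(z, w) ↦ (ω z, ω̄ w)` on `ℂ² = ℝ⁴`, where `ω = exp (2πi/3)`. -/
noncomputable def matA : Matrix (Fin 4) (Fin 4) ℝ :=
  !![-(1 / 2), -(√3 / 2), 0, 0; √3 / 2, -(1 / 2), 0, 0;
    0, 0, -(1 / 2), √3 / 2; 0, 0, -(√3 / 2), -(1 / 2)]

/-- The matrix of `(z, w) ↦ (i w, z)` on `ℂ² = ℝ⁴`. -/
def matB : Matrix (Fin 4) (Fin 4) ℝ :=
  !![0, 0, 0, -1; 0, 0, 1, 0; 1, 0, 0, 0; 0, 1, 0, 0]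

theorem matA_mem : matA ∈ Matrix.orthogonalGroup (Fin 4) ℝ := by
  have h3 : √3 * √3 = (3 : ℝ) := Real.mul_self_sqrt (by norm_num)
  rw [Matrix.mem_orthogonalGroup_iff]
  ext i j
  fin_cases i <;> fin_cases j <;>
    simp [matA, Matrix.mul_apply, Fin.sum_univ_four] <;> linarith

theorem matB_mem : matB ∈ Matrix.orthogonalGroup (Fin 4) ℝ := by
  rw [Matrix.mem_orthogonalGroup_iff]
  ext i j
  fin_cases i <;> fin_cases j <;>
    simp [matB, Matrix.mul_apply, Fin.sum_univ_four]

theorem matA_sq : matA ^ 2 = -matA - 1 := by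
  have h3 : √3 * √3 = (3 : ℝ) := Real.mul_self_sqrt (by norm_num)
  rw [pow_two]
  ext i j
  fin_cases i <;> fin_cases j <;>
    simp [matA, Matrix.mul_apply, Fin.sum_univ_four] <;> linarith

theorem matB_pow_four : matB ^ 4 = -1 := by
  rw [pow_mul matB 2 2, pow_two, pow_two]
  ext i j
  fin_cases i <;> fin_cases j <;>
    simp [matB, Matrix.mul_apply, Fin.sum_univ_four]

theorem matB_mul_matA : matB * matA = matA ^ 2 * matB := by
  rw [matA_sq]
  ext i j
  fin_cases i <;> fin_cases j <;>
    simp [matA, matB, Matrix.mul_apply, Fin.sum_univ_four]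
  all_goals norm_num

theorem exists_orthogonal :
    ∃ R : PresentedGroup sphereRels →* Matrix.orthogonalGroup (Fin 4) ℝ,
      (R a : Matrix (Fin 4) (Fin 4) ℝ) = matA ∧ (R b : Matrix (Fin 4) (Fin 4) ℝ) = matB := by
  have hA3 : matA ^ 3 = 1 := by
    rw [pow_succ, matA_sq, sub_mul, neg_mul, ← pow_two, matA_sq, one_mul]; abel
  have hB8 : matB ^ 8 = 1 := by
    rw [show 8 = 4 * 2 from rfl, pow_mul, matB_pow_four, neg_one_sq]
  obtain ⟨R, hR⟩ := exists_hom_comp_mk_eq (rels := sphereRels)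
    (FreeGroup.lift ![(⟨matA, matA_mem⟩ : Matrix.orthogonalGroup (Fin 4) ℝ), ⟨matB, matB_mem⟩])
      fun r hr => by
        simp only [sphereRels, Set.mem_insert_iff, Set.mem_singleton_iff] at hr
        rcases hr with rfl | rfl | rfl
        · simp only [genA, map_pow, FreeGroup.lift_apply_of]
          exact Subtype.ext hA3
        · simp only [genB, map_pow, FreeGroup.lift_apply_of]
          exact Subtype.ext hB8
        · simp only [genA, genB, map_mul, map_pow, map_inv, FreeGroup.lift_apply_of]
          rw [mul_inv_eq_one, mul_inv_eq_iff_eq_mul]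
          exact Subtype.ext matB_mul_matA
  refine ⟨R, ?_, ?_⟩
  · change ((R.comp (PresentedGroup.mk sphereRels) genA : _) : Matrix (Fin 4) (Fin 4) ℝ) = _
    simp [hR, genA]
  · change ((R.comp (PresentedGroup.mk sphereRels) genB : _) : Matrix (Fin 4) (Fin 4) ℝ) = _
    simp [hR, genB]

/-- A representation in which `a` satisfies `1 + a + a² = 0` and `b ^ 4` acts as `-1` is
fixed-point free. -/
theorem eq_zero_of_apply_eq {K V : Type*} [Field K] [CharZero K] [AddCommGroup V] [Module K V]
    {ρ : Representation K (PresentedGroup sphereRels) V} (ha : ρ a ^ 2 = -ρ a - 1)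
    (hb : ρ b ^ 4 = -1) {g : PresentedGroup sphereRels} (hg : g ≠ 1) {v : V} (hv : ρ g v = v) :
    v = 0 := by
  have hinv : ρ g⁻¹ v = v := by
    conv_lhs => rw [← hv, ← Module.End.mul_apply, ← map_mul, inv_mul_cancel, map_one]
    rfl
  have hpow (x : PresentedGroup sphereRels) (hx : ρ x v = v) (n : ℕ) : ρ (x ^ n) v = v := by
    induction n with
    | zero => simp
    | succ n ih => rw [pow_succ, map_mul, Module.End.mul_apply, hx, ih]
  have hzpow (k : ℤ) : ρ (g ^ k) v = v := by
    obtain ⟨n, rfl | rfl⟩ := k.eq_nat_or_neg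
    · rw [zpow_natCast]; exact hpow g hv n
    · rw [zpow_neg, zpow_natCast, ← inv_pow]; exact hpow _ hinv n
  obtain ⟨k, hk | hk⟩ := exists_zpow_eq hg
  · have h1 : ρ a v = v := by rw [← hk]; exact hzpow k
    have h2 := LinearMap.congr_fun ha v
    simp only [pow_two, Module.End.mul_apply, h1, LinearMap.sub_apply, LinearMap.neg_apply,
      Module.End.one_apply] at h2
    have h3 : (3 : K) • v = 0 := by
      rw [show (3 : K) • v = v - (-v - v) by module, sub_eq_zero]
      exact h2
    exact (smul_eq_zero.1 h3).resolve_left (by norm_num)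
  · have h1 : ρ (b ^ 4) v = v := by rw [← hk]; exact hzpow k
    rw [map_pow, hb, LinearMap.neg_apply, Module.End.one_apply] at h1
    have h3 : (2 : K) • v = 0 := by
      rw [show (2 : K) • v = v - -v by module, sub_eq_zero]
      exact h1.symm
    exact (smul_eq_zero.1 h3).resolve_left (by norm_num)

theorem actsFreelyLinearlyOnSphere :
    ActsFreelyLinearlyOnSphere (PresentedGroup sphereRels) := by
  obtain ⟨R, hRa, hRb⟩ := exists_orthogonal
  let ψ : Matrix (Fin 4) (Fin 4) ℝ →⋆*
      (EuclideanSpace ℝ (Fin 4) →L[ℝ] EuclideanSpace ℝ (Fin 4)) :=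
    { toFun := Matrix.toEuclideanCLM (𝕜 := ℝ)
      map_one' := map_one _
      map_mul' := map_mul _
      map_star' := map_star _ }
  let Ψ : Matrix.orthogonalGroup (Fin 4) ℝ →*
      (EuclideanSpace ℝ (Fin 4) ≃ₗᵢ[ℝ] EuclideanSpace ℝ (Fin 4)) :=
    Unitary.linearIsometryEquiv.toMonoidHom.comp (Unitary.map ψ).toMonoidHom
  refine ⟨3, Ψ.comp R, fun g hg v hv hfix => ?_⟩
  let σ : Representation ℝ (PresentedGroup sphereRels) (Fin 4 → ℝ) :=
    (Matrix.toLinAlgEquiv' : Matrix (Fin 4) (Fin 4) ℝ ≃ₐ[ℝ] _).toAlgHom.toMonoidHom.comp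
      ((Matrix.orthogonalGroup (Fin 4) ℝ).subtype.comp R)
  have h0 : v.ofLp = 0 := by
    refine eq_zero_of_apply_eq (ρ := σ) ?_ ?_ hg (congrArg WithLp.ofLp hfix)
    · have h : σ a = Matrix.toLinAlgEquiv' matA := congrArg Matrix.toLinAlgEquiv' hRa
      rw [h, ← map_pow, matA_sq, map_sub, map_neg, map_one]
    · have h : σ b = Matrix.toLinAlgEquiv' matB := congrArg Matrix.toLinAlgEquiv' hRb
      rw [h, ← map_pow, matB_pow_four, map_neg, map_one]
  have : v = 0 := by
    ext i; exact congrFun h0 i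
  simp [this] at hv

theorem exists_primitiveFixesNoVector :
    ∃ ρ : Representation ℂ (PresentedGroup sphereRels) (Fin 4 → ℂ),
      PrimitiveFixesNoVector (PresentedGroup.mk sphereRels) ρ := by
  obtain ⟨R, hRa, hRb⟩ := exists_orthogonal
  let σ : Representation ℂ (PresentedGroup sphereRels) (Fin 4 → ℂ) :=
    (Matrix.toLinAlgEquiv' : Matrix (Fin 4) (Fin 4) ℂ ≃ₐ[ℂ] _).toAlgHom.toMonoidHom.comp
      ((Complex.ofRealHom.mapMatrix : Matrix (Fin 4) (Fin 4) ℝ →+* _).toMonoidHom.comp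
      ((Matrix.orthogonalGroup (Fin 4) ℝ).subtype.comp R))
  refine ⟨σ, fun γ hγ v hv => eq_zero_of_apply_eq (ρ := σ) ?_ ?_ (mk_ne_one hγ) hv⟩
  · have h : σ a = Matrix.toLinAlgEquiv' (Complex.ofRealHom.mapMatrix matA) :=
      congrArg (fun M => Matrix.toLinAlgEquiv' (Complex.ofRealHom.mapMatrix M)) hRa
    rw [h, ← map_pow, ← map_pow, matA_sq]
    simp only [map_sub, map_neg, map_one]
  · have h : σ b = Matrix.toLinAlgEquiv' (Complex.ofRealHom.mapMatrix matB) :=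
      congrArg (fun M => Matrix.toLinAlgEquiv' (Complex.ofRealHom.mapMatrix M)) hRb
    rw [h, ← map_pow, ← map_pow, matB_pow_four]
    simp only [map_neg, map_one]

theorem IrrPr_ssubset : IrrPr (PresentedGroup.mk sphereRels) ⊂ Set.univ := by
  obtain ⟨ρ, hρ⟩ := exists_primitiveFixesNoVector
  exact hρ.IrrPr_ssubset_univ

theorem H1prim_lt :
    H1prim (PresentedGroup.mk sphereRels) < (coverGraph (PresentedGroup.mk sphereRels)).H1 := by
  obtain ⟨ρ, hρ⟩ := exists_primitiveFixesNoVector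
  have := finite
  exact hρ.H1prim_lt_H1

end SphereGroup

/-! ### Iterated homology covers of the torus with one boundary component -/

section ModHomologyKernel

variable {F : Type*} [Group F] {m : ℕ} {H L : Subgroup F}

theorem commutator_mem_modHomologyKernel {x y : F} (hx : x ∈ H) (hy : y ∈ H) :
    ⁅x, y⁆ ∈ modHomologyKernel m H :=
  Subgroup.mem_sup_left (Subgroup.commutator_mem_commutator hx hy)

theorem pow_mem_modHomologyKernel {x : F} (hx : x ∈ H) : x ^ m ∈ modHomologyKernel m H :=
  Subgroup.mem_sup_right (Subgroup.subset_closure ⟨x, hx, rfl⟩)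

theorem modHomologyKernel_le (hcomm : ∀ x ∈ H, ∀ y ∈ H, ⁅x, y⁆ ∈ L) (hpow : ∀ x ∈ H, x ^ m ∈ L) :
    modHomologyKernel m H ≤ L := by
  refine sup_le (Subgroup.commutator_le.2 hcomm) ((Subgroup.closure_le _).2 ?_)
  rintro _ ⟨x, hx, rfl⟩
  exact hpow x hx

end ModHomologyKernel

/-- The kernel `K` of the mod-2 homology map of the free group of rank two. -/
abbrev modTwoKernel : Subgroup (FreeGroup (Fin 2)) := modHomologyKernel 2 ⊤

theorem torusKernel_le_ker {H : Type*} [Group H] (p : ℕ) (f : FreeGroup (Fin 2) →* H)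
    (L : Subgroup H) (hL : modTwoKernel ≤ L.comap f) (hcomm : ∀ x ∈ L, ∀ y ∈ L, Commute x y)
    (hpow : ∀ x ∈ L, x ^ p = 1) : torusKernel p ≤ f.ker := by
  refine modHomologyKernel_le (fun x hx y hy => ?_) fun x hx => ?_
  · rw [MonoidHom.mem_ker, map_commutatorElement, commutatorElement_eq_one_iff_commute]
    exact hcomm _ (hL hx) _ (hL hy)
  · rw [MonoidHom.mem_ker, map_pow]
    exact hpow _ (hL hx)

/-- The Schreier generators of `K` for the transversal `1, a, b, ab`. -/
def schreierGen : Fin 5 → FreeGroup (Fin 2) :=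
  ![genA * genA, genB⁻¹ * genA * genA * genB, genB * genB, genB⁻¹ * genA⁻¹ * genB * genA,
    genA⁻¹ * genB * genA * genB]

theorem schreierGen_mem (j : Fin 5) : schreierGen j ∈ modTwoKernel := by
  have hsq (x : FreeGroup (Fin 2)) : x * x ∈ modTwoKernel := by
    rw [← pow_two]; exact pow_mem_modHomologyKernel trivial
  fin_cases j
  · exact hsq _
  · convert hsq (genB⁻¹ * genA * genB) using 1
    simp [schreierGen, mul_assoc]
  · exact hsq _
  · have h : ⁅genB⁻¹, genA⁻¹⁆ ∈ modTwoKernel := commutator_mem_modHomologyKernel trivial trivial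
    simpa [schreierGen, commutatorElement_def] using h
  · have h : ⁅genA⁻¹, genB⁆ ∈ modTwoKernel := commutator_mem_modHomologyKernel trivial trivial
    convert mul_mem h (hsq genB) using 1
    simp [schreierGen, commutatorElement_def, mul_assoc]

theorem exists_eq_transversal_mul (x : FreeGroup (Fin 2)) :
    ∃ t, (t = 1 ∨ t = genA ∨ t = genB ∨ t = genA * genB) ∧
      ∃ k ∈ Subgroup.closure (Set.range schreierGen), x = t * k := by
  have hgen (j : Fin 5) : schreierGen j ∈ Subgroup.closure (Set.range schreierGen) :=
    Subgroup.subset_closure ⟨j, rfl⟩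
  -- Left multiplication by `s` carries the coset of `t` to that of `t'` when `t'⁻¹ * s * t` lies in
  -- the subgroup; read backwards, the same membership serves for `s⁻¹`.
  have forward {s t : FreeGroup (Fin 2)} (t' : FreeGroup (Fin 2)) {k : FreeGroup (Fin 2)}
      (h : t'⁻¹ * s * t ∈ Subgroup.closure (Set.range schreierGen))
      (hk : k ∈ Subgroup.closure (Set.range schreierGen)) :
      ∃ l ∈ Subgroup.closure (Set.range schreierGen), s * (t * k) = t' * l :=
    ⟨_, mul_mem h hk, by group⟩
  have backward {s t' : FreeGroup (Fin 2)} (t : FreeGroup (Fin 2)) {k : FreeGroup (Fin 2)}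
      (h : t'⁻¹ * s * t ∈ Subgroup.closure (Set.range schreierGen))
      (hk : k ∈ Subgroup.closure (Set.range schreierGen)) :
      ∃ l ∈ Subgroup.closure (Set.range schreierGen), s⁻¹ * (t' * k) = t * l :=
    ⟨_, mul_mem (inv_mem h) hk, by group⟩
  have a1 : genA⁻¹ * genA * 1 ∈ Subgroup.closure (Set.range schreierGen) := by simp
  have aa : 1⁻¹ * genA * genA ∈ Subgroup.closure (Set.range schreierGen) := by
    convert hgen 0 using 1; simp [schreierGen, mul_assoc]
  have ab : (genA * genB)⁻¹ * genA * genB ∈ Subgroup.closure (Set.range schreierGen) := by simp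
  have aab : genB⁻¹ * genA * (genA * genB) ∈ Subgroup.closure (Set.range schreierGen) := by
    convert hgen 1 using 1; simp [schreierGen, mul_assoc]
  have b1 : genB⁻¹ * genB * 1 ∈ Subgroup.closure (Set.range schreierGen) := by simp
  have bb : 1⁻¹ * genB * genB ∈ Subgroup.closure (Set.range schreierGen) := by
    convert hgen 2 using 1; simp [schreierGen, mul_assoc]
  have ba : (genA * genB)⁻¹ * genB * genA ∈ Subgroup.closure (Set.range schreierGen) := by
    convert hgen 3 using 1; simp [schreierGen, mul_assoc]
  have bab : genA⁻¹ * genB * (genA * genB) ∈ Subgroup.closure (Set.range schreierGen) := by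
    convert hgen 4 using 1; simp [schreierGen, mul_assoc]
  induction x using freeGroup_induction_left with
  | one => exact ⟨1, by simp, 1, one_mem _, by simp⟩
  | mulA y hy =>
    obtain ⟨t, ht, k, hk, rfl⟩ := hy
    rcases ht with rfl | rfl | rfl | rfl
    · exact ⟨genA, by simp, forward _ a1 hk⟩
    · exact ⟨1, by simp, forward _ aa hk⟩
    · exact ⟨genA * genB, by simp, forward _ ab hk⟩
    · exact ⟨genB, by simp, forward _ aab hk⟩
  | invA y hy =>
    obtain ⟨t, ht, k, hk, rfl⟩ := hy
    rcases ht with rfl | rfl | rfl | rfl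
    · exact ⟨genA, by simp, backward _ aa hk⟩
    · exact ⟨1, by simp, backward _ a1 hk⟩
    · exact ⟨genA * genB, by simp, backward _ aab hk⟩
    · exact ⟨genB, by simp, backward _ ab hk⟩
  | mulB y hy =>
    obtain ⟨t, ht, k, hk, rfl⟩ := hy
    rcases ht with rfl | rfl | rfl | rfl
    · exact ⟨genB, by simp, forward _ b1 hk⟩
    · exact ⟨genA * genB, by simp, forward _ ba hk⟩
    · exact ⟨1, by simp, forward _ bb hk⟩
    · exact ⟨genA, by simp, forward _ bab hk⟩
  | invB y hy =>
    obtain ⟨t, ht, k, hk, rfl⟩ := hy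
    rcases ht with rfl | rfl | rfl | rfl
    · exact ⟨genB, by simp, backward _ bb hk⟩
    · exact ⟨genA * genB, by simp, backward _ bab hk⟩
    · exact ⟨1, by simp, backward _ b1 hk⟩
    · exact ⟨genA, by simp, backward _ ba hk⟩

theorem modTwoKernel_le_ker : modTwoKernel ≤ (modHomology 2 2).ker := by
  refine modHomologyKernel_le (fun x _ y _ => ?_) fun x _ => ?_
  · rw [MonoidHom.mem_ker, map_commutatorElement, commutatorElement_eq_one_iff_commute]
    exact Commute.all _ _
  · rw [MonoidHom.mem_ker, map_pow]
    have h (q : Multiplicative (Fin 2 → ZMod 2)) : q ^ 2 = 1 := by revert q; decide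
    exact h _

theorem ker_le_closure_schreierGen :
    (modHomology 2 2).ker ≤ Subgroup.closure (Set.range schreierGen) := by
  intro x hx
  obtain ⟨t, ht, k, hk, rfl⟩ := exists_eq_transversal_mul x
  have hkK : k ∈ (modHomology 2 2).ker := by
    refine modTwoKernel_le_ker (((Subgroup.closure_le _).2 ?_) hk)
    rintro _ ⟨j, rfl⟩
    exact schreierGen_mem j
  have ht1 : modHomology 2 2 t = 1 := by
    have := mul_mem hx (inv_mem hkK)
    rwa [mul_inv_cancel_right] at this
  rcases ht with rfl | rfl | rfl | rfl
  · rwa [one_mul]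
  all_goals
    exfalso
    revert ht1
    simp only [map_mul, modHomology_genA, modHomology_genB]
    decide

/-! ### The rank of the homology of the cover -/

section EdgeCount

variable (p : ℕ)

/-- The cocycle which counts the passages of the lift of a word through the edges outside a spanning
tree of the four-sheeted cover: `edgeWeight p i q` is the contribution of the edge which
corresponds to the `i`-th generator and starts at the vertex `q`. The group acts from the left, so
words are read from right to left, which matches the order in `schreierGen`. -/
def edgeWeight (i : Fin 2) (q : Fin 2 → ZMod 2) : Fin 5 → ZMod p :=
  if i = 0 then
    if q 0 = 0 then 0 else if q 1 = 0 then Pi.single 0 1 else Pi.single 1 1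
  else
    if q 0 = 0 then (if q 1 = 0 then 0 else Pi.single 2 1)
    else if q 1 = 0 then Pi.single 3 1 else Pi.single 4 1

/-- The action of the `i`-th generator on the mod-`p` homology cover of the four-sheeted cover. -/
def edgeShift (i : Fin 2) : Equiv.Perm ((Fin 2 → ZMod 2) × (Fin 5 → ZMod p)) where
  toFun s := (s.1 + Pi.single i 1, s.2 + edgeWeight p i s.1)
  invFun s := (s.1 - Pi.single i 1, s.2 - edgeWeight p i (s.1 - Pi.single i 1))
  left_inv s := by simp
  right_inv s := by simp

/-- The action of the free group on the mod-`p` homology cover of the four-sheeted cover. -/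
def edgeAction : FreeGroup (Fin 2) →* Equiv.Perm ((Fin 2 → ZMod 2) × (Fin 5 → ZMod p)) :=
  FreeGroup.lift (edgeShift p)

theorem edgeAction_apply (x : FreeGroup (Fin 2)) (q : Fin 2 → ZMod 2) (v : Fin 5 → ZMod p) :
    edgeAction p x (q, v) =
      (q + (modHomology 2 2 x).toAdd, v + (edgeAction p x (q, 0)).2) := by
  induction x using FreeGroup.induction_on generalizing q v with
  | C1 => simp
  | of i => simp [edgeAction, edgeShift, modHomology]
  | inv_of i _ =>
    simp [edgeAction, edgeShift, modHomology, Equiv.Perm.inv_def, sub_eq_add_neg]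
  | mul x y hx hy =>
    rw [map_mul, Equiv.Perm.mul_apply, hy q v, hx, map_mul, Equiv.Perm.mul_apply, hy q 0,
      hx _ (0 + _)]
    ext1
    · simp; abel
    · simp; abel

/-- The permutations that translate the fibres over the four-sheeted cover. -/
def fibreTranslations : Subgroup (Equiv.Perm ((Fin 2 → ZMod 2) × (Fin 5 → ZMod p))) where
  carrier := {g | ∃ u : (Fin 2 → ZMod 2) → Fin 5 → ZMod p, ∀ s, g s = (s.1, s.2 + u s.1)}
  one_mem' := ⟨0, fun s => by simp⟩
  mul_mem' := by
    rintro g h ⟨u, hu⟩ ⟨w, hw⟩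
    refine ⟨w + u, fun s => ?_⟩
    simp [hu, hw, add_assoc]
  inv_mem' := by
    rintro g ⟨u, hu⟩
    refine ⟨-u, fun s => ?_⟩
    rw [Equiv.Perm.inv_eq_iff_eq, hu]
    simp

theorem torusKernel_le_ker_edgeAction : torusKernel p ≤ (edgeAction p).ker := by
  refine torusKernel_le_ker p _ (fibreTranslations p) (fun x hx => ?_) ?_ ?_
  · refine ⟨fun q => (edgeAction p x (q, 0)).2, fun s => ?_⟩
    rw [edgeAction_apply, (modTwoKernel_le_ker hx : modHomology 2 2 x = 1)]
    simp
  · rintro g ⟨u, hu⟩ h ⟨w, hw⟩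
    ext1 s
    simp [hu, hw, add_right_comm]
  · rintro g ⟨u, hu⟩
    have h (n : ℕ) (s) : (g ^ n) s = (s.1, s.2 + n • u s.1) := by
      induction n with
      | zero => simp
      | succ n ih => rw [pow_succ', Equiv.Perm.mul_apply, ih, hu, succ_nsmul, add_assoc]
    ext1 s
    rw [h]
    simp

theorem edgeAction_schreierGen (j : Fin 5) :
    edgeAction p (schreierGen j) (0, 0) = (0, Pi.single j 1) := by
  fin_cases j <;>
    simp [schreierGen, edgeAction, genA, genB, edgeShift, edgeWeight, Equiv.Perm.inv_def]
  · decide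
  · exact ⟨by decide, fun h => absurd (by decide) h⟩
  · decide
  · decide

/-- The homology classes of the Schreier generators form a basis: they span because they generate
`K`, and the edge counts show that they are independent. -/
theorem exists_exact_sequence_torus [NeZero p] :
    ∃ (ι : Multiplicative (Fin 5 → ZMod p) →* FreeGroup (Fin 2) ⧸ torusKernel p)
      (π : FreeGroup (Fin 2) ⧸ torusKernel p →* Multiplicative (Fin 2 → ZMod 2)),
      Function.Injective ι ∧ Function.Surjective π ∧ ι.range = π.ker ∧
        π.comp (QuotientGroup.mk' (torusKernel p)) = modHomology 2 2 := by
  set mk := QuotientGroup.mk' (torusKernel p)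
  have hN : torusKernel p ≤ modTwoKernel :=
    modHomologyKernel_le (fun x hx y hy => Subgroup.commutator_le_left _ _
      (Subgroup.commutator_mem_commutator hx hy)) fun x hx => pow_mem hx p
  have hone {x : FreeGroup (Fin 2)} (hx : x ∈ torusKernel p) : mk x = 1 :=
    (QuotientGroup.eq_one_iff x).2 hx
  have hpow (j : Fin 5) : mk (schreierGen j) ^ p = 1 := by
    rw [← map_pow]
    exact hone (pow_mem_modHomologyKernel (schreierGen_mem j))
  have hcomm : Pairwise fun i j => ∀ (x y : Multiplicative (ZMod p)),
      Commute (cyclicHom p _ (hpow i) x) (cyclicHom p _ (hpow j) y) := by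
    intro i j _ x y
    obtain ⟨m, hm⟩ := ZMod.intCast_surjective x.toAdd
    obtain ⟨n, hn⟩ := ZMod.intCast_surjective y.toAdd
    obtain rfl : x = Multiplicative.ofAdd (m : ZMod p) := by rw [hm]; rfl
    obtain rfl : y = Multiplicative.ofAdd (n : ZMod p) := by rw [hn]; rfl
    rw [cyclicHom_ofAdd_intCast, cyclicHom_ofAdd_intCast]
    apply Commute.zpow_zpow
    rw [← commutatorElement_eq_one_iff_commute, ← map_commutatorElement]
    exact hone (commutator_mem_modHomologyKernel (schreierGen_mem i) (schreierGen_mem j))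
  set ι : Multiplicative (Fin 5 → ZMod p) →* FreeGroup (Fin 2) ⧸ torusKernel p :=
    (MonoidHom.noncommPiCoprod (fun j => cyclicHom p _ (hpow j)) hcomm).comp
      (MulEquiv.piMultiplicative fun _ : Fin 5 => ZMod p).toMonoidHom with hι
  have hιj (j : Fin 5) : ι (Multiplicative.ofAdd (Pi.single j 1)) = mk (schreierGen j) := by
    have h1 : MulEquiv.piMultiplicative (fun _ : Fin 5 => ZMod p)
        (Multiplicative.ofAdd (Pi.single j 1)) =
          Pi.mulSingle j (Multiplicative.ofAdd ((1 : ℤ) : ZMod p)) := by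
      ext i
      by_cases h : i = j
      · subst h; simp
      · simp [h]
    rw [hι, MonoidHom.comp_apply, MulEquiv.coe_toMonoidHom, h1, MonoidHom.noncommPiCoprod_mulSingle, cyclicHom_ofAdd_intCast, zpow_one]
  let π := QuotientGroup.lift (torusKernel p) (modHomology 2 2) (hN.trans modTwoKernel_le_ker)
  let θ := QuotientGroup.lift (torusKernel p) (edgeAction p) (torusKernel_le_ker_edgeAction p)
  refine ⟨ι, π, ?_, ?_, ?_, MonoidHom.ext fun _ => rfl⟩
  · -- the edge counts recover the exponents
    have hθ (v : Fin 5 → ZMod p) (u : Fin 5 → ZMod p) :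
        θ (ι (Multiplicative.ofAdd v)) (0, u) = (0, u + v) := by
      have hgen (j : Fin 5) (u : Fin 5 → ZMod p) :
          θ (ι (Multiplicative.ofAdd (Pi.single j 1))) (0, u) = (0, u + Pi.single j 1) := by
        rw [hιj]
        change edgeAction p (schreierGen j) (0, u) = _
        rw [edgeAction_apply, edgeAction_schreierGen,
          (modTwoKernel_le_ker (schreierGen_mem j) : modHomology 2 2 (schreierGen j) = 1)]
        simp
      have hadd (v w : Fin 5 → ZMod p)
          (hv : ∀ u, θ (ι (Multiplicative.ofAdd v)) (0, u) = (0, u + v))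
          (hw : ∀ u, θ (ι (Multiplicative.ofAdd w)) (0, u) = (0, u + w)) (u) :
          θ (ι (Multiplicative.ofAdd (v + w))) (0, u) = (0, u + (v + w)) := by
        rw [ofAdd_add, map_mul, map_mul, Equiv.Perm.mul_apply, hw, hv, add_assoc, add_comm w v]
      have hzero (u) : θ (ι (Multiplicative.ofAdd 0)) (0, u) = (0, u + 0) := by simp
      have hv : v = ∑ j, (v j).val • (Pi.single j 1 : Fin 5 → ZMod p) := by
        conv_lhs => rw [← Finset.univ_sum_single v]
        refine Finset.sum_congr rfl fun j _ => ?_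
        rw [← Pi.single_smul, nsmul_one, ZMod.natCast_zmod_val]
      revert u
      rw [hv]
      refine Finset.sum_induction _
        (fun v => ∀ u, θ (ι (Multiplicative.ofAdd v)) (0, u) = (0, u + v)) hadd hzero
        fun j _ => ?_
      induction (v j).val with
      | zero => rw [zero_smul]; exact hzero
      | succ n ih => rw [succ_nsmul]; exact hadd _ _ ih (hgen j)
    intro v w hvw
    have h1 := hθ v.toAdd 0
    have h2 := hθ w.toAdd 0
    rw [ofAdd_toAdd] at h1 h2
    rw [hvw, h2] at h1
    simpa using h1.symm
  · intro q
    refine ⟨mk (genA ^ (q.toAdd 0).val * genB ^ (q.toAdd 1).val), ?_⟩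
    change modHomology 2 2 _ = q
    rw [map_mul, map_pow, map_pow, modHomology_genA, modHomology_genB]
    revert q
    decide
  · apply le_antisymm
    · rintro _ ⟨v, rfl⟩
      have hmem : ι v ∈ (MonoidHom.noncommPiCoprod
        (fun j => cyclicHom p _ (hpow j)) hcomm).range := ⟨_, rfl⟩
      rw [MonoidHom.noncommPiCoprod_range] at hmem
      refine (show _ ≤ π.ker from iSup_le fun j => ?_) hmem
      rintro _ ⟨x, rfl⟩
      obtain ⟨m, hm⟩ := ZMod.intCast_surjective x.toAdd
      obtain rfl : x = Multiplicative.ofAdd (m : ZMod p) := by rw [hm]; rfl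
      rw [cyclicHom_ofAdd_intCast]
      exact zpow_mem (modTwoKernel_le_ker (schreierGen_mem j) : mk (schreierGen j) ∈ π.ker) m
    · intro g hg
      obtain ⟨x, rfl⟩ := QuotientGroup.mk'_surjective _ g
      have hle : Subgroup.closure (Set.range schreierGen) ≤ ι.range.comap mk := by
        rw [Subgroup.closure_le]
        rintro _ ⟨j, rfl⟩
        exact ⟨_, hιj j⟩
      exact hle (ker_le_closure_schreierGen hg)

theorem finite_quotient_torusKernel [NeZero p] :
    Finite (FreeGroup (Fin 2) ⧸ torusKernel p) := by
  obtain ⟨ι, π, -, -, hker, -⟩ := exists_exact_sequence_torus p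
  have : Finite π.ker := by
    rw [← hker]
    exact Set.finite_range ι
  refine Nat.finite_of_card_ne_zero ?_
  rw [← π.ker.card_mul_index, Subgroup.index_ker]
  exact mul_ne_zero Nat.card_pos.ne' Nat.card_pos.ne'

end EdgeCount

/-! ### The quaternion representation of the mod-2 cover -/

theorem torusKernel_two_le_ker : torusKernel 2 ≤ quaternionHom.ker := by
  let L : Subgroup (QuaternionGroup 2) :=
    { carrier := {x | x = 1 ∨ x = .a 2}
      one_mem' := Or.inl rfl
      mul_mem' := by rintro _ _ (rfl | rfl) (rfl | rfl) <;> decide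
      inv_mem' := by rintro _ (rfl | rfl) <;> decide }
  refine torusKernel_le_ker 2 quaternionHom L (modHomologyKernel_le ?_ ?_) ?_ ?_
  · intro x _ y _
    rw [Subgroup.mem_comap, map_commutatorElement]
    change _ ∨ _
    generalize quaternionHom x = g
    generalize quaternionHom y = h
    cases g <;> cases h <;> rename_i i j <;> revert i j <;> decide
  · intro x _
    rw [Subgroup.mem_comap, map_pow]
    change _ ∨ _
    generalize quaternionHom x = g
    cases g <;> rename_i i <;> revert i <;> decide
  · rintro x (rfl | rfl) y (rfl | rfl) <;> unfold Commute SemiconjBy <;> decide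
  · rintro x (rfl | rfl) <;> decide

theorem exists_primitiveFixesNoVector_two :
    ∃ ρ : Representation ℂ (FreeGroup (Fin 2) ⧸ torusKernel 2) (Fin 2 → ℂ),
      PrimitiveFixesNoVector (QuotientGroup.mk' (torusKernel 2)) ρ :=
  ⟨_, primitiveFixesNoVector_quaternion
    (f := QuotientGroup.lift (torusKernel 2) quaternionHom torusKernel_two_le_ker)
    (MonoidHom.ext fun _ => rfl)⟩

/-! ### Dihedral quotients of the mod-`p` covers for odd `p` -/

section Dihedral

variable (p : ℕ)

/-- The homomorphism from a dihedral group to `ℤ/2` whose kernel is the group of rotations. -/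
def dihedralSign : DihedralGroup p →* Multiplicative (ZMod 2) where
  toFun
    | .r _ => 1
    | .sr _ => Multiplicative.ofAdd 1
  map_one' := rfl
  map_mul' := by
    rintro (i | i) (j | j)
    · rfl
    · rfl
    · rfl
    · change (1 : Multiplicative (ZMod 2)) = Multiplicative.ofAdd 1 * Multiplicative.ofAdd 1
      decide

variable {p}

theorem exists_eq_r_of_dihedralSign {g : DihedralGroup p} (h : dihedralSign p g = 1) :
    ∃ t, g = .r t := by
  cases g with
  | r t => exact ⟨t, rfl⟩
  | sr t => exact absurd h (by change ¬ Multiplicative.ofAdd (1 : ZMod 2) = 1; decide)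

theorem mul_self_eq_one_of_dihedralSign {g : DihedralGroup p} (h : dihedralSign p g ≠ 1) :
    g * g = 1 := by
  cases g with
  | r t => exact absurd rfl h
  | sr t => simp

theorem torusKernel_le_ker_dihedral (f : FreeGroup (Fin 2) →* DihedralGroup p) :
    torusKernel p ≤ f.ker := by
  refine torusKernel_le_ker p f (dihedralSign p).ker (modHomologyKernel_le ?_ ?_) ?_ ?_
  · intro x _ y _
    rw [Subgroup.mem_comap, MonoidHom.mem_ker, map_commutatorElement, map_commutatorElement,
      commutatorElement_eq_one_iff_commute]
    exact Commute.all _ _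
  · intro x _
    rw [Subgroup.mem_comap, MonoidHom.mem_ker, map_pow, map_pow]
    have h (q : Multiplicative (ZMod 2)) : q ^ 2 = 1 := by revert q; decide
    exact h _
  · intro x hx y hy
    obtain ⟨s, rfl⟩ := exists_eq_r_of_dihedralSign hx
    obtain ⟨t, rfl⟩ := exists_eq_r_of_dihedralSign hy
    simp [Commute, SemiconjBy, add_comm]
  · intro x hx
    obtain ⟨s, rfl⟩ := exists_eq_r_of_dihedralSign hx
    rw [DihedralGroup.r_pow, CharP.cast_eq_zero, mul_zero]
    rfl

/-- In a dihedral quotient of odd degree, a primitive element whose image is a rotation has an image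
whose square is a nontrivial rotation, since the quotient is not cyclic. -/
theorem exists_mul_self_eq_r (hp : Odd p) {f : FreeGroup (Fin 2) →* DihedralGroup p}
    {u v : FreeGroup (Fin 2)} (huv : ¬ Commute (f u) (f v)) {x : FreeGroup (Fin 2)}
    (hx : IsPrimitive x) (hsign : dihedralSign p (f x) = 1) :
    ∃ s ≠ 0, f x * f x = .r s := by
  obtain ⟨t, ht⟩ := exists_eq_r_of_dihedralSign hsign
  refine ⟨t + t, fun h0 => huv (hx.commute f ?_ u v), by rw [ht]; rfl⟩
  have h2 : IsUnit ((2 : ℕ) : ZMod p) :=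
    (ZMod.isUnit_iff_coprime 2 p).2 (Nat.coprime_two_left.2 hp)
  rw [← two_mul] at h0
  have : t = 0 := h2.mul_left_cancel (by rw [mul_zero]; exact_mod_cast h0)
  rw [ht, this]
  rfl

/-- The three dihedral quotients, one for each of the homomorphisms onto `ℤ/2`. -/
def dihedralHom (p : ℕ) : Fin 3 → FreeGroup (Fin 2) →* DihedralGroup p :=
  ![FreeGroup.lift ![.r 1, .sr 0], FreeGroup.lift ![.sr 0, .r 1], FreeGroup.lift ![.sr 0, .sr 1]]

theorem not_commute_dihedralHom [Fact (2 < p)] (k : Fin 3) :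
    ¬ Commute (dihedralHom p k genA) (dihedralHom p k genB) := by
  have h1 : (1 : ZMod p) ≠ -1 := (ZMod.neg_one_ne_one (n := p)).symm
  fin_cases k <;>
    simp [dihedralHom, genA, genB, Commute, SemiconjBy, h1, h1.symm]

/-- The images of a primitive element in the three dihedral quotients are one rotation and two
reflections, because its mod-2 homology class is nonzero. -/
theorem dihedralSign_of_isPrimitive {x : FreeGroup (Fin 2)} (hx : IsPrimitive x) :
    ∃ k, dihedralSign p (dihedralHom p k x) = 1 ∧
      ∀ l ≠ k, dihedralSign p (dihedralHom p l x) ≠ 1 := by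
  let c : Fin 3 → Multiplicative (Fin 2 → ZMod 2) →* Multiplicative (ZMod 2) := fun k =>
    AddMonoidHom.toMultiplicative
      (![Pi.evalAddMonoidHom (fun _ : Fin 2 => ZMod 2) 1,
        Pi.evalAddMonoidHom (fun _ : Fin 2 => ZMod 2) 0,
        Pi.evalAddMonoidHom (fun _ : Fin 2 => ZMod 2) 0 +
          Pi.evalAddMonoidHom (fun _ : Fin 2 => ZMod 2) 1] k)
  have hc (k : Fin 3) : dihedralSign p (dihedralHom p k x) = c k (modHomology 2 2 x) := by
    have h : (dihedralSign p).comp (dihedralHom p k) = (c k).comp (modHomology 2 2) := by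
      refine FreeGroup.ext_hom _ _ fun i => ?_
      fin_cases k <;> fin_cases i <;> simp [dihedralHom, modHomology] <;> rfl
    exact DFunLike.congr_fun h x
  simp_rw [hc]
  have hne : modHomology 2 2 x ≠ 1 := by
    intro h
    obtain ⟨y, hy⟩ := hx.exists_forall_mem_zpowers
    obtain ⟨m, hm⟩ := Subgroup.mem_zpowers_iff.1 (hy _ h genA)
    obtain ⟨n, hn⟩ := Subgroup.mem_zpowers_iff.1 (hy _ h genB)
    rw [modHomology_genA] at hm
    rw [modHomology_genB] at hn
    generalize modHomology 2 2 y = q at hm hn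
    have hq : q ^ (2 : ℤ) = 1 := by clear hm hn; revert q; decide
    have hpow (m : ℤ) : q ^ m = 1 ∨ q ^ m = q := by
      rcases Int.even_or_odd' m with ⟨r, rfl | rfl⟩
      · left; rw [zpow_mul, hq, one_zpow]
      · right; rw [zpow_add, zpow_mul, hq, one_zpow, one_mul, zpow_one]
    have hm' := hpow m
    have hn' := hpow n
    rw [hm] at hm'
    rw [hn] at hn'
    clear hm hn hpow hq hy
    revert q
    decide
  generalize modHomology 2 2 x = q at hne
  revert q
  decide

/-! ### Tensor products of dihedral representations -/

variable (p) in
/-- The two-dimensional representation of the dihedral group in which the rotations are diagonal and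
the reflections exchange the coordinate axes. -/
noncomputable def dihedralRep [NeZero p] : Representation ℂ (DihedralGroup p) (Fin 2 → ℂ) where
  toFun
    | .r i => Matrix.toLin' !![ZMod.stdAddChar i, 0; 0, ZMod.stdAddChar (-i)]
    | .sr i => Matrix.toLin' !![0, ZMod.stdAddChar (-i); ZMod.stdAddChar i, 0]
  map_one' := by
    change Matrix.toLin' !![ZMod.stdAddChar (0 : ZMod p), 0; 0, ZMod.stdAddChar (-0)] = 1
    rw [neg_zero, AddChar.map_zero_eq_one, ← Matrix.one_fin_two, Matrix.toLin'_one]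
    rfl
  map_mul' := by
    rintro (i | i) (j | j)
    · change Matrix.toLin' !![ZMod.stdAddChar (i + j), 0; 0, ZMod.stdAddChar (-(i + j))] =
        Matrix.toLin' _ ∘ₗ Matrix.toLin' _
      rw [← Matrix.toLin'_mul, Matrix.mul_fin_two]
      simp [AddChar.map_add_eq_mul, mul_comm]
    · change Matrix.toLin' !![0, ZMod.stdAddChar (-(j - i)); ZMod.stdAddChar (j - i), 0] =
        Matrix.toLin' _ ∘ₗ Matrix.toLin' _
      rw [← Matrix.toLin'_mul, Matrix.mul_fin_two]
      simp [AddChar.map_add_eq_mul, sub_eq_add_neg, mul_comm]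
    · change Matrix.toLin' !![0, ZMod.stdAddChar (-(i + j)); ZMod.stdAddChar (i + j), 0] =
        Matrix.toLin' _ ∘ₗ Matrix.toLin' _
      rw [← Matrix.toLin'_mul, Matrix.mul_fin_two]
      simp [AddChar.map_add_eq_mul, mul_comm]
    · change Matrix.toLin' !![ZMod.stdAddChar (j - i), 0; 0, ZMod.stdAddChar (-(j - i))] =
        Matrix.toLin' _ ∘ₗ Matrix.toLin' _
      rw [← Matrix.toLin'_mul, Matrix.mul_fin_two]
      simp [AddChar.map_add_eq_mul, sub_eq_add_neg, mul_comm]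

theorem isUnit_dihedralRep_r_sub_one [NeZero p] {s : ZMod p} (hs : s ≠ 0) :
    IsUnit (dihedralRep p (.r s) - 1) := by
  have h : dihedralRep p (.r s) - 1 = Matrix.toLinAlgEquiv'
      (!![ZMod.stdAddChar s - 1, 0; 0, ZMod.stdAddChar (-s) - 1] : Matrix (Fin 2) (Fin 2) ℂ) := by
    have h1 : (!![ZMod.stdAddChar s - 1, 0; 0, ZMod.stdAddChar (-s) - 1] :
        Matrix (Fin 2) (Fin 2) ℂ) = !![ZMod.stdAddChar s, 0; 0, ZMod.stdAddChar (-s)] - 1 := by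
      ext i j
      fin_cases i <;> fin_cases j <;> simp
    rw [h1, map_sub, map_one]
    rfl
  have hne {t : ZMod p} (ht : t ≠ 0) : ZMod.stdAddChar t - (1 : ℂ) ≠ 0 := by
    rw [sub_ne_zero, ← AddChar.map_zero_eq_one (ZMod.stdAddChar (N := p))]
    exact fun h => ht (ZMod.injective_stdAddChar h)
  rw [h]
  refine IsUnit.map _ ((Matrix.isUnit_iff_isUnit_det _).2 ?_)
  rw [Matrix.det_fin_two_of, mul_zero, sub_zero, isUnit_iff_ne_zero]
  exact mul_ne_zero (hne hs) (hne (neg_ne_zero.2 hs))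

theorem isUnit_rTensor_sub_one {V W : Type*} [AddCommGroup V] [Module ℂ V] [AddCommGroup W]
    [Module ℂ W] {T : Module.End ℂ V} (hT : IsUnit (T - 1)) :
    IsUnit (TensorProduct.map T (1 : Module.End ℂ W) - 1) := by
  have h := hT.map (Module.End.rTensorAlgHom ℂ V W)
  rwa [map_sub, map_one] at h

theorem isUnit_lTensor_sub_one {V W : Type*} [AddCommGroup V] [Module ℂ V] [AddCommGroup W]
    [Module ℂ W] {T : Module.End ℂ W} (hT : IsUnit (T - 1)) :
    IsUnit (TensorProduct.map (1 : Module.End ℂ V) T - 1) := by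
  have h := hT.map (Module.End.lTensorAlgHom ℂ W V)
  rwa [map_sub, map_one] at h

theorem eq_zero_of_isUnit_sub_one {V : Type*} [AddCommGroup V] [Module ℂ V] {T : Module.End ℂ V}
    (hT : IsUnit (T - 1)) {v : V} (hv : T v = v) : v = 0 := by
  obtain ⟨S, hS⟩ := hT.exists_left_inv
  have h := LinearMap.congr_fun hS v
  simpa [hv] using h.symm

/-- The square of a primitive element acts on the tensor product of the three dihedral
representations through a single factor, where it is a nontrivial rotation; such a rotation has no
eigenvalue `1`. -/
theorem exists_primitiveFixesNoVector_odd (hp : Odd p) [Fact (2 < p)] [NeZero p] :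
    ∃ ρ : Representation ℂ (FreeGroup (Fin 2) ⧸ torusKernel p)
        ((Fin 2 → ℂ) ⊗[ℂ] ((Fin 2 → ℂ) ⊗[ℂ] (Fin 2 → ℂ))),
      PrimitiveFixesNoVector (QuotientGroup.mk' (torusKernel p)) ρ := by
  let σ (k : Fin 3) : Representation ℂ (FreeGroup (Fin 2) ⧸ torusKernel p) (Fin 2 → ℂ) :=
    (dihedralRep p).comp
      (QuotientGroup.lift (torusKernel p) (dihedralHom p k) (torusKernel_le_ker_dihedral _))
  refine ⟨(σ 0).tprod ((σ 1).tprod (σ 2)), fun x hx v hv => ?_⟩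
  set g := QuotientGroup.mk' (torusKernel p) x
  have hσ (k : Fin 3) : σ k (g * g) = dihedralRep p (dihedralHom p k x * dihedralHom p k x) := by
    rw [← map_mul, ← map_mul]; rfl
  have hv2 : (σ 0).tprod ((σ 1).tprod (σ 2)) (g * g) v = v := by
    rw [map_mul, Module.End.mul_apply, hv, hv]
  rw [Representation.tprod_apply, Representation.tprod_apply] at hv2
  obtain ⟨k, hk, hl⟩ := dihedralSign_of_isPrimitive (p := p) hx
  obtain ⟨s, hs, hr⟩ := exists_mul_self_eq_r hp (not_commute_dihedralHom k) hx hk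
  have hT : IsUnit (σ k (g * g) - 1) := by
    rw [hσ, hr]; exact isUnit_dihedralRep_r_sub_one hs
  have hone (l : Fin 3) (hlk : l ≠ k) : σ l (g * g) = 1 := by
    rw [hσ, mul_self_eq_one_of_dihedralSign (hl l hlk), map_one]
  refine eq_zero_of_isUnit_sub_one ?_ hv2
  fin_cases k
  · rw [hone 1 (by decide), hone 2 (by decide), TensorProduct.map_one]
    exact isUnit_rTensor_sub_one hT
  · rw [hone 0 (by decide), hone 2 (by decide)]
    exact isUnit_lTensor_sub_one (isUnit_rTensor_sub_one hT)
  · rw [hone 0 (by decide), hone 1 (by decide)]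
    exact isUnit_lTensor_sub_one (isUnit_lTensor_sub_one hT)

end Dihedral

theorem IrrPr_and_H1prim_torus {p : ℕ} (hp : p.Prime) :
    IrrPr (QuotientGroup.mk' (torusKernel p)) ⊂ Set.univ ∧
      H1prim (QuotientGroup.mk' (torusKernel p)) <
        (coverGraph (QuotientGroup.mk' (torusKernel p))).H1 := by
  have : NeZero p := ⟨hp.ne_zero⟩
  have := finite_quotient_torusKernel p
  rcases hp.eq_two_or_odd' with rfl | hodd
  · obtain ⟨ρ, hρ⟩ := exists_primitiveFixesNoVector_two
    exact ⟨hρ.IrrPr_ssubset_univ, hρ.H1prim_lt_H1⟩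
  · have : Fact (2 < p) :=
      ⟨lt_of_le_of_ne hp.two_le fun h => by rw [← h] at hodd; exact absurd hodd (by decide)⟩
    obtain ⟨ρ, hρ⟩ := exists_primitiveFixesNoVector_odd hodd
    exact ⟨hρ.IrrPr_ssubset_univ, hρ.H1prim_lt_H1⟩

end PrimitiveHomology

theorem theorem1p5 :
    -- two-step nilpotent counterexamples exist
    (∃ (G : Type) (_ : Group G) (_ : Finite G) (φ : FreeGroup (Fin 2) →* G),
      Group.IsNilpotent G ∧ Group.nilpotencyClass G = 2 ∧
      Function.Surjective φ ∧
      IrrPr φ ⊂ Set.univ ∧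
      H1prim φ < (coverGraph φ).H1) ∧
    -- the group of order 24 acting freely and linearly on a sphere
    (Nat.card (PresentedGroup sphereRels) = 24 ∧
      ActsFreelyLinearlyOnSphere (PresentedGroup sphereRels) ∧
      Function.Surjective (PresentedGroup.mk sphereRels) ∧
      (∀ x, IsPrimitive x → PresentedGroup.mk sphereRels x ≠ 1) ∧
      IrrPr (PresentedGroup.mk sphereRels) ⊂ Set.univ ∧
      H1prim (PresentedGroup.mk sphereRels) <
        (coverGraph (PresentedGroup.mk sphereRels)).H1) ∧
    -- the two-step nilpotent group of order 32, with its two-dimensional representation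
    (Nat.card (PresentedGroup nilRels) = 32 ∧
      Group.IsNilpotent (PresentedGroup nilRels) ∧
      Group.nilpotencyClass (PresentedGroup nilRels) = 2 ∧
      (∃ (ι : Multiplicative (ZMod 2) →* PresentedGroup nilRels)
          (π : PresentedGroup nilRels →* Multiplicative (Fin 2 → ZMod 4)),
        Function.Injective ι ∧ Function.Surjective π ∧ ι.range = π.ker ∧
        π.comp (PresentedGroup.mk nilRels) = modHomology 2 4) ∧
      Function.Surjective (PresentedGroup.mk nilRels) ∧
      (∀ x, IsPrimitive x → PresentedGroup.mk nilRels x ≠ 1) ∧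
      (∃ (ρ : Representation ℂ (PresentedGroup nilRels) (Fin 2 → ℂ)) (hρ : ρ.IsIrreducible),
        ρ (PresentedGroup.mk nilRels genA) =
          Matrix.toLin' !![Complex.I, 0; 0, -Complex.I] ∧
        ρ (PresentedGroup.mk nilRels genB) = Matrix.toLin' !![0, 1; -1, 0] ∧
        (∀ x, IsPrimitive x →
          ¬ Module.End.HasEigenvalue (ρ (PresentedGroup.mk nilRels x)) (1 : ℂ)) ∧
        (IrrRep.mk 2 ρ hρ).cls ∉ IrrPr (PresentedGroup.mk nilRels) ∧
        PresentedGroup.mk nilRels (genA ^ 2 * genC) ≠ 1 ∧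
        ρ (PresentedGroup.mk nilRels (genA ^ 2 * genC)) = 1) ∧
      IrrPr (PresentedGroup.mk nilRels) ⊂ Set.univ ∧
      H1prim (PresentedGroup.mk nilRels) < (coverGraph (PresentedGroup.mk nilRels)).H1) ∧
    -- the iterated homology covers of the torus with one boundary component
    (∀ p : ℕ, p.Prime →
      (∃ (ι : Multiplicative (Fin 5 → ZMod p) →* FreeGroup (Fin 2) ⧸ torusKernel p)
          (π : FreeGroup (Fin 2) ⧸ torusKernel p →* Multiplicative (Fin 2 → ZMod 2)),
        Function.Injective ι ∧ Function.Surjective π ∧ ι.range = π.ker ∧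
        π.comp (QuotientGroup.mk' (torusKernel p)) = modHomology 2 2) ∧
      Finite (FreeGroup (Fin 2) ⧸ torusKernel p) ∧
      Function.Surjective (QuotientGroup.mk' (torusKernel p)) ∧
      IrrPr (QuotientGroup.mk' (torusKernel p)) ⊂ Set.univ ∧
      H1prim (QuotientGroup.mk' (torusKernel p)) <
        (coverGraph (QuotientGroup.mk' (torusKernel p))).H1) := by
  have hnil := NilGroup.finite
  refine ⟨⟨PresentedGroup nilRels, inferInstance, hnil, PresentedGroup.mk nilRels,
      NilGroup.isNilpotent, NilGroup.nilpotencyClass_eq, PresentedGroup.mk_surjective _,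
      NilGroup.IrrPr_ssubset, NilGroup.H1prim_lt⟩,
    ⟨SphereGroup.card, SphereGroup.actsFreelyLinearlyOnSphere, PresentedGroup.mk_surjective _,
      fun _ => SphereGroup.mk_ne_one, SphereGroup.IrrPr_ssubset, SphereGroup.H1prim_lt⟩,
    ⟨NilGroup.card, NilGroup.isNilpotent, NilGroup.nilpotencyClass_eq,
      NilGroup.exists_exact_sequence, PresentedGroup.mk_surjective _, fun _ => NilGroup.mk_ne_one,
      NilGroup.exists_representation, NilGroup.IrrPr_ssubset, NilGroup.H1prim_lt⟩,
    fun p hp => ?_⟩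
  have : NeZero p := ⟨hp.ne_zero⟩
  exact ⟨exists_exact_sequence_torus p, finite_quotient_torusKernel p,
    QuotientGroup.mk'_surjective _, IrrPr_and_H1prim_torus hp⟩
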